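/- **Theorem (stochastic Lipschitz continuity).** Let $k,p\ge 1$, let $Y_1,\dots,Y_N$ be independent random variables with values in a measurable space $\mathcal Y$, let $Z_1,\dots,Z_N$ be fixed real $k\times p$ matrices with entries $Z_{ijh}$ and rows $Z_{ij}^\top$, let $D\subset\mathbb R^p$, and fix $\theta\in D$. Let $\gamma_i:\mathbb R^k\times\mathcal Y\to\mathbb R$ be measurable in the second variable and differentiable in the first, with $\gamma_i(Z_iu,Y_i)$ integrable for $u\in D$, and suppose that $$F_1=\sup_{i,j,s,y}|\partial_j\gamma_i(s,y)|<\infty,\qquad F_2=\sup_{i,j,y}\ \sup_{s\ne t}\frac{|\partial_j\gamma_i(s,y)-\partial_j\gamma_i(t,y)|}{\|t-s\|_\infty}<\infty .$$ Put $M_Z=\max_{i,j,h}|Z_{ijh}|$, $R_D=\sup_{u,v\in D}\|u-v\|_1$ (if $R_D=\infty$, use $0\cdot\infty=0$), and write $[\![X]\!]=X-\mathbb E X$. Let $\beta_m$ be the least constant such that for all $n$, all bounded $T\subset(\mathbb R^m)^n$ and all $h_i:\mathbb R^m\to\mathbb R$ ($i\le n$) with $h_i(0)=0$ and $|h_i(t)-h_i(s)|\le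 M_i\|t-s\|_\infty$, $$\mathbb E\sup_{t\in T}\Big|\sum_{i}\varepsilon_ih_i(t_i)\Big|\le\beta_m\sum_{j=1}^m\mathbb E\sup_{t\in T}\Big|\sum_i\varepsilon_iM_it_{ij}\Big|,$$ where $\varepsilon_1,\dots,\varepsilon_n$ are independent Rademacher variables. Then $\beta_{2k}\le 3^{2k}+3^{2k-1}-2^{2k}$. Moreover, set $$\varphi=2\min(F_1,F_2M_ZR_D),\quad \bar\psi=2k\beta_{2k}M_ZF_2,\quad \bar A=4\sqrt{2k}\,R_D\bar\psi,\quad \bar B=\sqrt{2k}\,\varphi,\quad \bar C=8kM_Z\varphi,$$ $$\tau(q)=\bar A\sqrt{\ln(2p)\sum_{j}\max_{h}\sum_{i}Z_{ijh}^2}+\bar B\sqrt{\ln(p/q)\max_h\sum_{i,j}Z_{ijh}^2}+\bar C\ln(p/q).$$ (1) There is an $\mathbb R^p$-valued process $\xi(u,v)$, $u,v\in D$, such that for all $u,v\in D$ $$\sum_i[\![\gamma_i(Z_iu,Y_i)]\!]-\sum_i[\![\gamma_i(Z_iv,Y_i)]\!]=\sum_{i,j}[\![\partial_j\gamma_i(Z_i\theta,Y_i)]\!]\,Z_{ij}^\top(u-v)+\xi(u,v)^\top(u-v),$$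 and, for every $q\in(0,1)$, $\ \mathbb P\{\sup_{u,v\in D}\|\xi(u,v)\|_\infty>\tau(q)\}\le q$. (2) For every $q_0\in(0,1)$ and all $q,q'\in(0,1)$ with $q+q'=q_0$, with probability at least $1-q_0$, $$\sup_{u\ne v\in D}\frac{\big|\sum_i[\![\gamma_i(Z_iu,Y_i)]\!]-\sum_i[\![\gamma_i(Z_iv,Y_i)]\!]\big|}{\|u-v\|_1}\le\sqrt{2k}\,F_1\sqrt{\ln(2p/q')\max_h\sum_{i,j}Z_{ijh}^2}+\tau(q).$$ -/

import Mathlib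

open MeasureTheory ProbabilityTheory
open scoped ENNReal NNReal Matrix

noncomputable section

namespace StochLip

/-! All suprema are taken in `ℝ≥0∞`, so that they are genuine least upper bounds (possibly `∞`);
`0 * ∞ = 0` there. `‖x‖ₑ` is the (extended) norm of `x`: the absolute value on `ℝ`, and the
`ℓ_∞` norm on `Fin n → ℝ`. -/

/-- Square root on `[0, ∞]`. -/
def sqrtE (x : ℝ≥0∞) : ℝ≥0∞ := x ^ (1 / 2 : ℝ)

/-- The `ℓ₁` norm on `ℝⁿ`. -/
def l1Norm {n : ℕ} (x : Fin n → ℝ) : ℝ≥0∞ := ∑ h, ‖x h‖ₑ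

/-! ### The constant of the comparison inequality for Rademacher averages -/

/-- The expectation of `F(ε₁, …, ε_N)` for independent Rademacher variables `ε₁, …, ε_N`, that is,
the average of `F` over the `2 ^ N` sign vectors. -/
def rademacherMean (N : ℕ) (F : (Fin N → ℤˣ) → ℝ≥0∞) : ℝ≥0∞ := (∑ ε, F ε) / 2 ^ N

/-- `β` is a valid constant in the comparison inequality in dimension `m`: for every `N`, every
bounded `T ⊆ (ℝᵐ)ᴺ` and all functions `h_i : ℝᵐ → ℝ` that are `M_i`-Lipschitz with respect to
`ℓ_∞` and vanish at `0`,
`E sup_{t ∈ T} |∑ᵢ εᵢ hᵢ(tᵢ)| ≤ β ∑ⱼ E sup_{t ∈ T} |∑ᵢ εᵢ Mᵢ tᵢⱼ|`. -/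
def IsComparisonConstant (m : ℕ) (β : ℝ≥0∞) : Prop :=
  ∀ (N : ℕ) (T : Set (Fin N → Fin m → ℝ)) (M : Fin N → ℝ≥0) (h : Fin N → (Fin m → ℝ) → ℝ),
    Bornology.IsBounded T → (∀ i, LipschitzWith (M i) (h i)) → (∀ i, h i 0 = 0) →
      rademacherMean N (fun ε => ⨆ t ∈ T, ‖∑ i, ((ε i : ℤ) : ℝ) * h i (t i)‖ₑ) ≤
        β * ∑ j, rademacherMean N
          (fun ε => ⨆ t ∈ T, ‖∑ i, ((ε i : ℤ) : ℝ) * ((M i : ℝ) * t i j)‖ₑ)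

/-- `β_m`: the best constant in the comparison inequality in dimension `m`. -/
def betaConst (m : ℕ) : ℝ≥0∞ := sInf {β | IsComparisonConstant m β}

/-! ### Loss functions -/

/-- The partial derivative `∂_j f (t)`. -/
def partialDeriv {k : ℕ} (j : Fin k) (f : (Fin k → ℝ) → ℝ) (t : Fin k → ℝ) : ℝ :=
  fderiv ℝ f t (Pi.single j 1)

section loss

variable {N k : ℕ} {𝒴 : Type*}

/-- `F₁ = sup |∂_j γ_i(s, y)|`. -/
def F₁ (γ : Fin N → (Fin k → ℝ) → 𝒴 → ℝ) : ℝ≥0∞ :=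
  ⨆ (i : Fin N) (y : 𝒴) (j : Fin k) (s : Fin k → ℝ), ‖partialDeriv j (fun x => γ i x y) s‖ₑ

/-- `F₂ = sup_{s ≠ t} |∂_j γ_i(s, y) - ∂_j γ_i(t, y)| / ‖t - s‖_∞`. -/
def F₂ (γ : Fin N → (Fin k → ℝ) → 𝒴 → ℝ) : ℝ≥0∞ :=
  ⨆ (i : Fin N) (y : 𝒴) (j : Fin k) (s : Fin k → ℝ) (t : Fin k → ℝ) (_ : s ≠ t),
    ‖partialDeriv j (fun x => γ i x y) s - partialDeriv j (fun x => γ i x y) t‖ₑ / ‖t - s‖ₑ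

end loss

/-! ### Design matrices and parameter domain -/

section design

variable {N k p : ℕ}

/-- `M_Z = max_{i, j, h} |Z_{ijh}|`. -/
def MZ (Z : Fin N → Matrix (Fin k) (Fin p) ℝ) : ℝ≥0∞ :=
  ⨆ (i : Fin N) (j : Fin k) (h : Fin p), ‖Z i j h‖ₑ

/-- `R_D = sup_{u, v ∈ D} ‖u - v‖₁`. -/
def RD (D : Set (Fin p → ℝ)) : ℝ≥0∞ := ⨆ u ∈ D, ⨆ v ∈ D, l1Norm (u - v)

/-- `∑_j max_h ∑_i Z_{ijh}²`. -/
def sumMaxSq (Z : Fin N → Matrix (Fin k) (Fin p) ℝ) : ℝ≥0∞ :=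
  ∑ j, ⨆ h : Fin p, ∑ i, ‖Z i j h‖ₑ ^ 2

/-- `max_h ∑_{i, j} Z_{ijh}²`. -/
def maxSumSq (Z : Fin N → Matrix (Fin k) (Fin p) ℝ) : ℝ≥0∞ :=
  ⨆ h : Fin p, ∑ i, ∑ j, ‖Z i j h‖ₑ ^ 2

variable {𝒴 : Type*}

/-- `φ = 2 min(F₁, F₂ M_Z R_D)`. -/
def phi (γ : Fin N → (Fin k → ℝ) → 𝒴 → ℝ) (Z : Fin N → Matrix (Fin k) (Fin p) ℝ)
    (D : Set (Fin p → ℝ)) : ℝ≥0∞ :=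
  2 * min (F₁ γ) (F₂ γ * MZ Z * RD D)

/-- `ψ = 2 k β_{2k} M_Z F₂`. -/
def psi (γ : Fin N → (Fin k → ℝ) → 𝒴 → ℝ) (Z : Fin N → Matrix (Fin k) (Fin p) ℝ) : ℝ≥0∞ :=
  2 * k * betaConst (2 * k) * MZ Z * F₂ γ

/-- `A = 4 √(2k) R_D ψ`. -/
def constA (γ : Fin N → (Fin k → ℝ) → 𝒴 → ℝ) (Z : Fin N → Matrix (Fin k) (Fin p) ℝ)
    (D : Set (Fin p → ℝ)) : ℝ≥0∞ :=
  4 * sqrtE (2 * k) * RD D * psi γ Z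

/-- `B = √(2k) φ`. -/
def constB (γ : Fin N → (Fin k → ℝ) → 𝒴 → ℝ) (Z : Fin N → Matrix (Fin k) (Fin p) ℝ)
    (D : Set (Fin p → ℝ)) : ℝ≥0∞ :=
  sqrtE (2 * k) * phi γ Z D

/-- `C = 8 k M_Z φ`. -/
def constC (γ : Fin N → (Fin k → ℝ) → 𝒴 → ℝ) (Z : Fin N → Matrix (Fin k) (Fin p) ℝ)
    (D : Set (Fin p → ℝ)) : ℝ≥0∞ :=
  8 * k * (MZ Z * phi γ Z D)

/-- The bound for the remainder at level `q`:
`A √(ln(2p) ∑_j max_h ∑_i Z_{ijh}²) + B √(ln(p/q) max_h ∑_{i,j} Z_{ijh}²) + C ln(p/q)`. -/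
def tailBound (γ : Fin N → (Fin k → ℝ) → 𝒴 → ℝ) (Z : Fin N → Matrix (Fin k) (Fin p) ℝ)
    (D : Set (Fin p → ℝ)) (q : ℝ) : ℝ≥0∞ :=
  constA γ Z D * sqrtE (ENNReal.ofReal (Real.log (2 * p)) * sumMaxSq Z)
    + constB γ Z D * sqrtE (ENNReal.ofReal (Real.log (p / q)) * maxSumSq Z)
    + constC γ Z D * ENNReal.ofReal (Real.log (p / q))

/-- The bound for the linear term at level `q'`: `√(2k) F₁ √(ln(2p/q') max_h ∑_{i,j} Z_{ijh}²)`. -/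
def linearBound (γ : Fin N → (Fin k → ℝ) → 𝒴 → ℝ) (Z : Fin N → Matrix (Fin k) (Fin p) ℝ)
    (q' : ℝ) : ℝ≥0∞ :=
  sqrtE (2 * k) * F₁ γ * sqrtE (ENNReal.ofReal (Real.log (2 * p / q')) * maxSumSq Z)

end design

section random

variable {Ω 𝒴 : Type*} [MeasurableSpace Ω] {N k p : ℕ}

/-- The centered random variable `X - E X`. -/
def centered (P : Measure Ω) (X : Ω → ℝ) (ω : Ω) : ℝ := X ω - ∫ ω', X ω' ∂P

/-- The centered total loss `∑_i (γ_i(Z_i u, Y_i) - E γ_i(Z_i u, Y_i))`. -/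
def centeredLoss (P : Measure Ω) (γ : Fin N → (Fin k → ℝ) → 𝒴 → ℝ) (Y : Fin N → Ω → 𝒴)
    (Z : Fin N → Matrix (Fin k) (Fin p) ℝ) (u : Fin p → ℝ) (ω : Ω) : ℝ :=
  ∑ i, centered P (fun ω' => γ i (Z i *ᵥ u) (Y i ω')) ω

/-- The linear term `∑_{i,j} (∂_j γ_i(Z_i θ, Y_i) - E ∂_j γ_i(Z_i θ, Y_i)) Z_{ij}ᵀ w`. -/
def linearTerm (P : Measure Ω) (γ : Fin N → (Fin k → ℝ) → 𝒴 → ℝ) (Y : Fin N → Ω → 𝒴)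
    (Z : Fin N → Matrix (Fin k) (Fin p) ℝ) (θ w : Fin p → ℝ) (ω : Ω) : ℝ :=
  ∑ i, ∑ j, centered P (fun ω' => partialDeriv j (fun x => γ i x (Y i ω')) (Z i *ᵥ θ)) ω
    * (Z i j ⬝ᵥ w)

end random

end StochLip

end

/-! For `u ≠ v`, a vector with prescribed inner product `r` with `u - v` has sup norm at least `|r|
/ ‖u - v‖₁`, and a multiple of the sign vector of `u - v` attains this (`dualVector`). So (1) says
that the remainder `r` of the linear approximation is at most `τ(q) ‖u - v‖₁`, uniformly in `u`,
`v`. By the mean value inequality along the segment (`abs_remainder_le`), it suffices to bound each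
coordinate of the gradient of the centered loss at `w` minus that at `θ`, uniformly over `w` in the
`ℓ₁` ball of radius `R_D` about `θ`. This ball is convex, so it contains the segment even when `D`
does not.

For one coordinate and finitely many `w`, the supremum is the norm of a sum of independent centered
vectors. It concentrates around its mean by McDiarmid's inequality
(`hasSubgaussianMGF_of_boundedDifferences`). The mean is reduced to Rademacher averages by
symmetrization (`integral_norm_centered_sum_le`). Contraction (`expect_norm_contraction`) then
replaces the gradient increments by the linear forms `Z_{ij}ᵀ(w - θ)`, and `ℓ₁`-`ℓ_∞` duality with
the maximal inequality `expect_norm_rademacher_le` bounds these. Continuity in `w` gives the whole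
ball, and a union bound the `p` coordinates. As McDiarmid's tail is purely sub-Gaussian, the term
with `C` in `τ` is only slack.

Contraction trades the sign in front of `h_i` for `m` independent signs, one per coordinate, without
loss; only the absolute values cost a factor `2`. Hence `β_m ≤ 2` for every `m ≥ 1`, below the
asserted bound, while `τ` is reached using only `β_{2k} ≥ 1`. For (2), the linear term is controlled
by McDiarmid's inequality with both signs in each coordinate. -/

namespace StochLip

open scoped BigOperators

/-! ### Contraction for Rademacher averages: one sign traded for a vector of signs. -/

section Rademacher

variable {m : ℕ}

theorem abs_intUnit (e : ℤˣ) : |((e : ℤ) : ℝ)| = 1 := by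
  rcases Int.units_eq_one_or e with h | h <;> simp [h]

theorem expect_intUnit (f : ℤˣ → ℝ) : 𝔼 e, f e = (f 1 + f (-1)) / 2 := by
  rw [Fintype.expect_eq_sum_div_card]
  have h : (Finset.univ : Finset ℤˣ) = {1, -1} := by decide
  rw [h, Finset.sum_pair (by decide)]
  simp

/-- A coordinate is dominated by the mean of the absolute value of a random signed sum. -/
theorem abs_le_expect_abs_sum (v : Fin m → ℝ) (j : Fin m) :
    |v j| ≤ 𝔼 η : Fin m → ℤˣ, |∑ l, ((η l : ℤ) : ℝ) * v l| := by
  -- Flipping every sign except the `j`-th preserves the uniform law, and the two signed sums add up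
  -- to `2 η_j v_j`.
  let σ : Fin m → ℤˣ := fun l => if l = j then 1 else -1
  have hσ : 𝔼 η : Fin m → ℤˣ, |∑ l, (((σ * η) l : ℤ) : ℝ) * v l|
      = 𝔼 η : Fin m → ℤˣ, |∑ l, ((η l : ℤ) : ℝ) * v l| :=
    Fintype.expect_equiv (Equiv.mulLeft σ) _ _ (fun η => rfl)
  have key : ∀ η : Fin m → ℤˣ, 2 * |v j| ≤ |∑ l, ((η l : ℤ) : ℝ) * v l|
      + |∑ l, (((σ * η) l : ℤ) : ℝ) * v l| := by
    intro η
    have h1 : ∑ l, ((η l : ℤ) : ℝ) * v l + ∑ l, (((σ * η) l : ℤ) : ℝ) * v l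
        = 2 * (((η j : ℤ) : ℝ) * v j) := by
      rw [← Finset.sum_add_distrib, Finset.sum_eq_single j]
      · simp [σ]; ring
      · intro l _ hl
        simp [σ, hl]
      · simp
    have h2 := abs_add_le (∑ l, ((η l : ℤ) : ℝ) * v l) (∑ l, (((σ * η) l : ℤ) : ℝ) * v l)
    rw [h1, abs_mul, abs_mul, abs_intUnit] at h2
    simpa using h2
  have h3 := Finset.expect_le_expect (s := Finset.univ) (fun η _ => key η)
  rw [Finset.expect_add_distrib, hσ, Fintype.expect_const] at h3
  linarith

variable {ι : Type*} [Finite ι] [Nonempty ι]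

/-- The two suprema on the left are attained at some `x`, `y`, with mean half of `A x + A y + (a x -
a y)`. The last difference is at most the mean of `|∑ l, η l * (b l x - b l y)|`; adding `A x + A y`
to this absolute value gives at most the sum of the suprema for `η` and `-η`, whose means agree. -/
theorem expect_iSup_add_signed_le (A a : ι → ℝ) (b : Fin m → ι → ℝ)
    (h : ∀ x y, ∃ j, |a x - a y| ≤ |b j x - b j y|) :
    𝔼 e : ℤˣ, ⨆ x, (A x + ((e : ℤ) : ℝ) * a x) ≤
      𝔼 η : Fin m → ℤˣ, ⨆ x, (A x + ∑ j, ((η j : ℤ) : ℝ) * b j x) := by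
  rw [expect_intUnit]
  obtain ⟨x, hx⟩ := exists_eq_ciSup_of_finite (f := fun x => A x + (((1 : ℤˣ) : ℤ) : ℝ) * a x)
  obtain ⟨y, hy⟩ := exists_eq_ciSup_of_finite (f := fun x => A x + (((-1 : ℤˣ) : ℤ) : ℝ) * a x)
  rw [← hx, ← hy]
  obtain ⟨j, hj⟩ := h x y
  have h1 := abs_le_expect_abs_sum (fun l => b l x - b l y) j
  have hneg : 𝔼 η : Fin m → ℤˣ, ⨆ x, (A x + ∑ j, (((-η) j : ℤ) : ℝ) * b j x)
      = 𝔼 η : Fin m → ℤˣ, ⨆ x, (A x + ∑ j, ((η j : ℤ) : ℝ) * b j x) :=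
    Fintype.expect_equiv (Equiv.neg _) _ _ (fun η => rfl)
  have key : ∀ η : Fin m → ℤˣ, A x + A y + |∑ l, ((η l : ℤ) : ℝ) * (b l x - b l y)| ≤
      (⨆ x, (A x + ∑ j, ((η j : ℤ) : ℝ) * b j x))
        + ⨆ x, (A x + ∑ j, (((-η) j : ℤ) : ℝ) * b j x) := by
    intro η
    have bd : ∀ (η : Fin m → ℤˣ) z, A z + ∑ j, ((η j : ℤ) : ℝ) * b j z ≤
        ⨆ x, (A x + ∑ j, ((η j : ℤ) : ℝ) * b j x) := fun η z =>
      le_ciSup (f := fun x => A x + ∑ j, ((η j : ℤ) : ℝ) * b j x) (Set.finite_range _).bddAbove z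
    have e1 : ∀ z, ∑ j, (((-η) j : ℤ) : ℝ) * b j z = - ∑ j, ((η j : ℤ) : ℝ) * b j z := by
      intro z; simp
    have e2 : ∑ l, ((η l : ℤ) : ℝ) * (b l x - b l y)
        = ∑ l, ((η l : ℤ) : ℝ) * b l x - ∑ l, ((η l : ℤ) : ℝ) * b l y := by
      simp only [mul_sub, Finset.sum_sub_distrib]
    have b1 := bd η x
    have b2 := bd η y
    have b3 := bd (-η) x
    have b4 := bd (-η) y
    rw [e1] at b3 b4
    rw [e2]
    rcases abs_cases (∑ l, ((η l : ℤ) : ℝ) * b l x - ∑ l, ((η l : ℤ) : ℝ) * b l y) with h | h <;>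
      linarith [h.1]
  have h3 := Finset.expect_le_expect (s := Finset.univ) (fun η _ => key η)
  simp only [Finset.expect_add_distrib, hneg, Fintype.expect_const] at h3
  have := le_abs_self (a x - a y)
  simp only [Units.val_one, Int.cast_one, Units.val_neg, Int.cast_neg]
  linarith

theorem expect_fin_succ {N : ℕ} {S : Type*} [Fintype S] (F : (Fin (N + 1) → S) → ℝ) :
    𝔼 ε, F ε = 𝔼 e, 𝔼 ε, F (Fin.cons e ε) := by
  rw [← Finset.expect_product', Finset.univ_product_univ]
  exact Fintype.expect_equiv (Fin.consEquiv (fun _ => S)).symm _ _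
    (fun ε => by simp [Fin.consEquiv])

/-- Contraction for Rademacher averages of vector-valued families, without absolute values. -/
theorem expect_iSup_contraction {N : ℕ} (A : ι → ℝ) (a : Fin N → ι → ℝ)
    (b : Fin N → Fin m → ι → ℝ) (h : ∀ i x y, ∃ j, |a i x - a i y| ≤ |b i j x - b i j y|) :
    𝔼 ε : Fin N → ℤˣ, ⨆ x, (A x + ∑ i, ((ε i : ℤ) : ℝ) * a i x) ≤
      𝔼 η : Fin N → Fin m → ℤˣ, ⨆ x, (A x + ∑ i, ∑ j, ((η i j : ℤ) : ℝ) * b i j x) := by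
  -- `A` must vary: it absorbs the first signed term while the others are exchanged, and then the
  -- exchanged terms while the first is treated.
  induction N generalizing A with
  | zero => simp
  | succ N ih =>
    rw [expect_fin_succ, expect_fin_succ]
    simp only [Fin.sum_univ_succ, Fin.cons_zero, Fin.cons_succ]
    calc 𝔼 e : ℤˣ, 𝔼 ε : Fin N → ℤˣ,
          ⨆ x, (A x + (((e : ℤ) : ℝ) * a 0 x + ∑ i, ((ε i : ℤ) : ℝ) * a i.succ x))
        ≤ 𝔼 e : ℤˣ, 𝔼 η : Fin N → Fin m → ℤˣ,
          ⨆ x, ((A x + ∑ i, ∑ j, ((η i j : ℤ) : ℝ) * b i.succ j x) + ((e : ℤ) : ℝ) * a 0 x) := by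
          refine Finset.expect_le_expect fun e _ => ?_
          have := ih (fun x => A x + ((e : ℤ) : ℝ) * a 0 x) (fun i => a i.succ)
            (fun i => b i.succ) (fun i => h i.succ)
          simpa only [add_assoc, add_comm, add_left_comm] using this
      _ = 𝔼 η : Fin N → Fin m → ℤˣ, 𝔼 e : ℤˣ,
          ⨆ x, ((A x + ∑ i, ∑ j, ((η i j : ℤ) : ℝ) * b i.succ j x) + ((e : ℤ) : ℝ) * a 0 x) :=
          Finset.expect_comm _ _ _
      _ ≤ 𝔼 η : Fin N → Fin m → ℤˣ, 𝔼 η₀ : Fin m → ℤˣ,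
          ⨆ x, ((A x + ∑ i, ∑ j, ((η i j : ℤ) : ℝ) * b i.succ j x)
            + ∑ j, ((η₀ j : ℤ) : ℝ) * b 0 j x) :=
          Finset.expect_le_expect fun η _ => expect_iSup_add_signed_le _ _ _ (h 0)
      _ = _ := by
          rw [Finset.expect_comm]
          simp only [add_comm, add_left_comm]

end Rademacher

/-! ### Contraction with absolute values. -/

/-- The mean of a function of one coordinate. -/
theorem expect_apply_coord {m : ℕ} {S : Type*} [Fintype S] [Nonempty S] (j : Fin m) (F : S → ℝ) :
    𝔼 ζ : Fin m → S, F (ζ j) = 𝔼 s, F s := by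
  rw [Fintype.expect_equiv (Equiv.funSplitAt j S) (fun ζ => F (ζ j)) (fun z => F z.1)
    (fun ζ => by simp), ← Finset.univ_product_univ, Finset.expect_product]
  simp

theorem expect_apply_column {N m : ℕ} (j : Fin m) (F : (Fin N → ℤˣ) → ℝ) :
    𝔼 η : Fin N → Fin m → ℤˣ, F (fun i => η i j) = 𝔼 ε, F ε := by
  rw [← expect_apply_coord (m := m) j F]
  exact Fintype.expect_equiv (Equiv.piComm _) _ _ (fun η => rfl)

/-- Contraction for Rademacher averages, with absolute values: the norms are sup norms. -/
theorem expect_norm_contraction {N m : ℕ} {ι : Type*} [Fintype ι] (a : Fin N → ι → ℝ)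
    (b : Fin N → Fin m → ι → ℝ) (h : ∀ i x y, ∃ j, |a i x - a i y| ≤ |b i j x - b i j y|)
    (h₀ : ∀ i x, ∃ j, |a i x| ≤ |b i j x|) (hm : 0 < m) :
    𝔼 ε : Fin N → ℤˣ, ‖fun x => ∑ i, ((ε i : ℤ) : ℝ) * a i x‖ ≤
      2 * ∑ j, 𝔼 ε : Fin N → ℤˣ, ‖fun x => ∑ i, ((ε i : ℤ) : ℝ) * b i j x‖ := by
  -- The extra index `none` puts the zero function into the family, which makes all suprema
  -- nonnegative. An absolute value is then at most the sum of the suprema for `ε` and `-ε`; this is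
  -- the source of the factor `2`.
  let a' : Fin N → Option ι → ℝ := fun i o => o.elim 0 (a i)
  let b' : Fin N → Fin m → Option ι → ℝ := fun i j o => o.elim 0 (b i j)
  have h' : ∀ i x y, ∃ j, |a' i x - a' i y| ≤ |b' i j x - b' i j y| := by
    rintro i (_ | x) (_ | y)
    · exact ⟨⟨0, hm⟩, by simp [a', b']⟩
    · simpa [a', b'] using h₀ i y
    · simpa [a', b'] using h₀ i x
    · simpa [a', b'] using h i x y
  have c := expect_iSup_contraction (fun _ : Option ι => (0 : ℝ)) a' b' h'
  simp only [zero_add] at c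
  have bdd : ∀ f : Option ι → ℝ, BddAbove (Set.range f) := fun f => (Set.finite_range f).bddAbove
  have hneg : 𝔼 ε : Fin N → ℤˣ, ⨆ x, ∑ i, (((-ε) i : ℤ) : ℝ) * a' i x
      = 𝔼 ε : Fin N → ℤˣ, ⨆ x, ∑ i, ((ε i : ℤ) : ℝ) * a' i x :=
    Fintype.expect_equiv (Equiv.neg _) _ _ (fun η => rfl)
  have lower : 𝔼 ε : Fin N → ℤˣ, ‖fun x => ∑ i, ((ε i : ℤ) : ℝ) * a i x‖ ≤
      2 * 𝔼 ε : Fin N → ℤˣ, ⨆ x, ∑ i, ((ε i : ℤ) : ℝ) * a' i x := by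
    rw [two_mul]
    nth_rewrite 2 [← hneg]
    rw [← Finset.expect_add_distrib]
    refine Finset.expect_le_expect fun ε _ => ?_
    have n1 : ∀ ε : Fin N → ℤˣ, 0 ≤ ⨆ x, ∑ i, ((ε i : ℤ) : ℝ) * a' i x := fun ε =>
      le_ciSup_of_le (bdd _) none (by simp [a'])
    have n2 : ∀ (ε : Fin N → ℤˣ) x, ∑ i, ((ε i : ℤ) : ℝ) * a i x ≤
        ⨆ x, ∑ i, ((ε i : ℤ) : ℝ) * a' i x := fun ε x =>
      le_ciSup_of_le (bdd _) (some x) le_rfl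
    refine (pi_norm_le_iff_of_nonneg (add_nonneg (n1 _) (n1 _))).2 fun x => ?_
    have e1 : ∑ i, (((-ε) i : ℤ) : ℝ) * a i x = - ∑ i, ((ε i : ℤ) : ℝ) * a i x := by simp
    have b1 := n2 ε x
    have b2 := n2 (-ε) x
    rw [e1] at b2
    rw [Real.norm_eq_abs, abs_le]
    constructor <;> linarith [n1 ε, n1 (-ε)]
  have upper : 𝔼 η : Fin N → Fin m → ℤˣ, ⨆ x, ∑ i, ∑ j, ((η i j : ℤ) : ℝ) * b' i j x ≤
      ∑ j, 𝔼 ε : Fin N → ℤˣ, ‖fun x => ∑ i, ((ε i : ℤ) : ℝ) * b i j x‖ := by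
    have e : ∑ j, 𝔼 ε : Fin N → ℤˣ, ‖fun x => ∑ i, ((ε i : ℤ) : ℝ) * b i j x‖ =
        𝔼 η : Fin N → Fin m → ℤˣ, ∑ j, ‖fun x => ∑ i, ((η i j : ℤ) : ℝ) * b i j x‖ := by
      rw [Finset.expect_sum_comm]
      exact Finset.sum_congr rfl fun j _ => (expect_apply_column j
        (fun ε => ‖fun x => ∑ i, ((ε i : ℤ) : ℝ) * b i j x‖)).symm
    rw [e]
    refine Finset.expect_le_expect fun η _ => ciSup_le ?_
    rintro (_ | x)
    · simpa [b'] using Finset.sum_nonneg fun j _ => norm_nonneg _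
    · rw [Finset.sum_comm]
      exact Finset.sum_le_sum fun j _ => (le_abs_self _).trans
        (norm_le_pi_norm (fun x => ∑ i, ((η i j : ℤ) : ℝ) * b i j x) x)
  linarith

/-! ### Exponential moments and the maximal inequality. -/

theorem expect_exp_rademacher {N : ℕ} (a : Fin N → ℝ) :
    𝔼 ε : Fin N → ℤˣ, Real.exp (∑ i, ((ε i : ℤ) : ℝ) * a i) ≤ Real.exp ((∑ i, a i ^ 2) / 2) := by
  induction N with
  | zero => simp
  | succ N ih =>
    rw [expect_fin_succ]
    simp only [Fin.sum_univ_succ, Fin.cons_zero, Fin.cons_succ, Real.exp_add, add_div]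
    simp only [← Finset.mul_expect, ← Finset.expect_mul]
    refine mul_le_mul ?_ (ih _) (Finset.expect_nonneg fun _ _ => (Real.exp_pos _).le)
      (Real.exp_pos _).le
    rw [expect_intUnit]
    simpa [Real.cosh_eq] using Real.cosh_le_exp_half_sq (a 0)

theorem two_log_pos {p : ℕ} (hp : 0 < p) : 0 < Real.log (2 * p) :=
  Real.log_pos (by have : (1 : ℝ) ≤ p := by exact_mod_cast hp
                   linarith)

/-- The maximal inequality for finitely many Rademacher sums. -/
theorem expect_norm_rademacher_le {N p : ℕ} (hp : 0 < p) (c : Fin N → Fin p → ℝ) {V : ℝ}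
    (hV : ∀ h, ∑ i, c i h ^ 2 ≤ V) :
    𝔼 ε : Fin N → ℤˣ, ‖fun h => ∑ i, ((ε i : ℤ) : ℝ) * c i h‖ ≤
      √2 * √(Real.log (2 * p)) * √V := by
  have V0 : 0 ≤ V := (Finset.sum_nonneg fun i _ => sq_nonneg _).trans (hV ⟨0, hp⟩)
  set ℓ := Real.log (2 * p) with hℓ
  have ℓ0 : 0 < ℓ := two_log_pos hp
  set E := 𝔼 ε : Fin N → ℤˣ, ‖fun h => ∑ i, ((ε i : ℤ) : ℝ) * c i h‖ with hE
  have key : ∀ t : ℝ, 0 < t → t * E ≤ ℓ + t ^ 2 * V / 2 := by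
    intro t ht
    have h1 : ∀ ε : Fin N → ℤˣ, Real.exp (t * ‖fun h => ∑ i, ((ε i : ℤ) : ℝ) * c i h‖) ≤
        ∑ h, (Real.exp (∑ i, ((ε i : ℤ) : ℝ) * (t * c i h))
          + Real.exp (∑ i, ((ε i : ℤ) : ℝ) * (-t * c i h))) := by
      intro ε
      obtain ⟨h, hh⟩ : ∃ h, ‖fun h => ∑ i, ((ε i : ℤ) : ℝ) * c i h‖
          ≤ |∑ i, ((ε i : ℤ) : ℝ) * c i h| := by
        obtain ⟨h, -, hh⟩ := Finset.exists_max_image (Finset.univ : Finset (Fin p))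
          (fun h => |∑ i, ((ε i : ℤ) : ℝ) * c i h|) ⟨⟨0, hp⟩, Finset.mem_univ _⟩
        exact ⟨h, (pi_norm_le_iff_of_nonneg (abs_nonneg _)).2 fun x => hh x (Finset.mem_univ _)⟩
      refine le_trans ?_ (Finset.single_le_sum (f := fun h =>
        (Real.exp (∑ i, ((ε i : ℤ) : ℝ) * (t * c i h))
          + Real.exp (∑ i, ((ε i : ℤ) : ℝ) * (-t * c i h))))
        (fun h _ => by positivity) (Finset.mem_univ h))
      have e1 : ∑ i, ((ε i : ℤ) : ℝ) * (t * c i h) = t * ∑ i, ((ε i : ℤ) : ℝ) * c i h := by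
        rw [Finset.mul_sum]; exact Finset.sum_congr rfl fun i _ => by ring
      have e2 : ∑ i, ((ε i : ℤ) : ℝ) * (-t * c i h) = -(t * ∑ i, ((ε i : ℤ) : ℝ) * c i h) := by
        rw [Finset.mul_sum, ← Finset.sum_neg_distrib]
        exact Finset.sum_congr rfl fun i _ => by ring
      rw [e1, e2]
      have h2 := mul_le_mul_of_nonneg_left hh ht.le
      refine (Real.exp_le_exp.2 h2).trans ?_
      rcases abs_cases (∑ i, ((ε i : ℤ) : ℝ) * c i h) with h3 | h3
      · rw [h3.1]; linarith [Real.exp_pos (-(t * ∑ i, ((ε i : ℤ) : ℝ) * c i h))]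
      · rw [h3.1, mul_neg]; linarith [Real.exp_pos ((t * ∑ i, ((ε i : ℤ) : ℝ) * c i h))]
    have mg : ∀ (s : ℝ) h, s ^ 2 = t ^ 2 →
        𝔼 ε : Fin N → ℤˣ, Real.exp (∑ i, ((ε i : ℤ) : ℝ) * (s * c i h)) ≤
          Real.exp (t ^ 2 * V / 2) := by
      intro s h hs
      refine (expect_exp_rademacher _).trans (Real.exp_le_exp.2 ?_)
      simp only [mul_pow, hs, ← Finset.mul_sum]
      have := mul_le_mul_of_nonneg_left (hV h) (sq_nonneg t)
      linarith
    have h2 : 𝔼 ε : Fin N → ℤˣ, Real.exp (t * ‖fun h => ∑ i, ((ε i : ℤ) : ℝ) * c i h‖) ≤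
        Real.exp (ℓ + t ^ 2 * V / 2) := by
      refine (Finset.expect_le_expect fun ε _ => h1 ε).trans ?_
      rw [Finset.expect_sum_comm]
      refine (Finset.sum_le_sum (g := fun _ => 2 * Real.exp (t ^ 2 * V / 2)) fun h _ => ?_).trans ?_
      · rw [Finset.expect_add_distrib, two_mul]
        exact add_le_add (mg t h rfl) (mg (-t) h (neg_sq t))
      · rw [Real.exp_add, hℓ, Real.exp_log (by positivity)]
        simp only [Finset.sum_const, Finset.card_univ, Fintype.card_fin, nsmul_eq_mul]
        exact le_of_eq (by ring)
    -- This takes the place of Jensen's inequality: with `c = ℓ + t ^ 2 * V / 2`, the logarithm lies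
    -- below its tangent at `exp c`, that is, `x ≤ c - 1 + exp (x - c)`.
    have h3 : ∀ ε : Fin N → ℤˣ, t * ‖fun h => ∑ i, ((ε i : ℤ) : ℝ) * c i h‖ ≤
        (ℓ + t ^ 2 * V / 2) - 1 + Real.exp (-(ℓ + t ^ 2 * V / 2)) *
          Real.exp (t * ‖fun h => ∑ i, ((ε i : ℤ) : ℝ) * c i h‖) := by
      intro ε
      rw [← Real.exp_add]
      linarith [Real.add_one_le_exp (-(ℓ + t ^ 2 * V / 2)
        + t * ‖fun h => ∑ i, ((ε i : ℤ) : ℝ) * c i h‖)]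
    have h4 := Finset.expect_le_expect (s := Finset.univ) (fun ε _ => h3 ε)
    rw [Finset.expect_add_distrib, ← Finset.mul_expect, ← Finset.mul_expect,
      Fintype.expect_const] at h4
    have h5 := mul_le_mul_of_nonneg_left h2 (Real.exp_pos (-(ℓ + t ^ 2 * V / 2))).le
    rw [← Real.exp_add, neg_add_cancel, Real.exp_zero] at h5
    linarith
  -- The optimal parameter `t = √(2 ℓ / V)`, written below as `s / V` with `s = √(2 ℓ V)`, requires
  -- `V > 0`; for `V = 0` all coefficients vanish.
  rcases V0.eq_or_lt with h0 | hpos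
  · have hc : ∀ i h, c i h = 0 := by
      intro i h
      have h1 := hV h
      rw [← h0] at h1
      have h2 := (Finset.single_le_sum (f := fun i => c i h ^ 2) (fun i _ => sq_nonneg _)
        (Finset.mem_univ i)).trans h1
      exact pow_eq_zero_iff two_ne_zero |>.1 (le_antisymm h2 (sq_nonneg _))
    have : E = 0 := by
      rw [hE]
      refine Finset.expect_eq_zero fun ε _ => ?_
      simp only [hc, mul_zero, Finset.sum_const_zero]
      exact norm_zero
    rw [this]; positivity
  · have hs : 0 < √2 * √ℓ * √V := by positivity
    have hs2 : (√2 * √ℓ * √V) ^ 2 = 2 * ℓ * V := by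
      rw [mul_pow, mul_pow, Real.sq_sqrt (by norm_num), Real.sq_sqrt ℓ0.le, Real.sq_sqrt V0]
    set s := √2 * √ℓ * √V
    have h1 := key (s / V) (by positivity)
    have h2 : (s / V) ^ 2 * V / 2 = ℓ := by
      rw [div_pow, hs2]; field_simp
    rw [h2] at h1
    have h3 : s / V * E * V ≤ (ℓ + ℓ) * V := mul_le_mul_of_nonneg_right h1 V0
    have h4 : s / V * E * V = s * E := by field_simp
    rw [h4] at h3
    have h5 : s * E ≤ s * s := by nlinarith
    exact le_of_mul_le_mul_left h5 hs

/-! ### Bounds for the comparison constant. -/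

theorem enorm_pi_eq_iSup {ι : Type*} [Fintype ι] (f : ι → ℝ) : ‖f‖ₑ = ⨆ x, ‖f x‖ₑ := by
  refine le_antisymm ?_ (iSup_le fun x => ?_)
  · rcases isEmpty_or_nonempty ι with h | h
    · have : f = 0 := Subsingleton.elim _ _
      simp [this]
    · obtain ⟨x, -, hx⟩ := Finset.exists_max_image (Finset.univ : Finset ι) (fun x => ‖f x‖)
        Finset.univ_nonempty
      refine le_trans ?_ (le_iSup _ x)
      rw [enorm_le_iff_norm_le]
      exact (pi_norm_le_iff_of_nonneg (norm_nonneg _)).2 fun y => hx y (Finset.mem_univ _)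
  · rw [enorm_le_iff_norm_le]
    exact norm_le_pi_norm f x

theorem rademacherMean_enorm {N : ℕ} {E : Type*} [NormedAddCommGroup E]
    (f : (Fin N → ℤˣ) → E) :
    rademacherMean N (fun ε => ‖f ε‖ₑ) = ENNReal.ofReal (𝔼 ε, ‖f ε‖) := by
  rw [rademacherMean, Fintype.expect_eq_sum_div_card, ENNReal.ofReal_div_of_pos (by positivity),
    ENNReal.ofReal_sum_of_nonneg fun _ _ => norm_nonneg _]
  congr 1
  · simp
  · simp [ENNReal.ofReal_pow]

theorem rademacherMean_mono {N : ℕ} {F G : (Fin N → ℤˣ) → ℝ≥0∞} (h : ∀ ε, F ε ≤ G ε) :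
    rademacherMean N F ≤ rademacherMean N G :=
  ENNReal.div_le_div_right (Finset.sum_le_sum fun ε _ => h ε) _

theorem exists_norm_le_abs_apply {m : ℕ} (hm : 0 < m) (v : Fin m → ℝ) : ∃ j, ‖v‖ ≤ |v j| := by
  obtain ⟨j, -, hj⟩ := Finset.exists_max_image (Finset.univ : Finset (Fin m))
    (fun j => |v j|) ⟨⟨0, hm⟩, Finset.mem_univ _⟩
  exact ⟨j, (pi_norm_le_iff_of_nonneg (abs_nonneg _)).2 fun x => hj x (Finset.mem_univ _)⟩

/-- An increment of an `ℓ_∞`-Lipschitz function is dominated by the scaled increment of some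
coordinate, which is the hypothesis of the contraction. The contraction applies to finite subsets of
`T`. -/
theorem isComparisonConstant_two {m : ℕ} (hm : 0 < m) : IsComparisonConstant m 2 := by
  intro N T M h _ hLip h0
  have fin : ∀ S : Finset T,
      rademacherMean N (fun ε => ⨆ t ∈ S, ‖∑ i, ((ε i : ℤ) : ℝ) * h i (t.1 i)‖ₑ) ≤
        2 * ∑ j, rademacherMean N
          (fun ε => ⨆ t ∈ T, ‖∑ i, ((ε i : ℤ) : ℝ) * ((M i : ℝ) * t i j)‖ₑ) := by
    intro S
    have hb : ∀ i (x y : Fin m → ℝ), ∃ j, |h i x - h i y| ≤ |(M i : ℝ) * x j - M i * y j| := by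
      intro i x y
      obtain ⟨j, hj⟩ := exists_norm_le_abs_apply hm (x - y)
      refine ⟨j, ?_⟩
      have h1 := (hLip i).dist_le_mul x y
      rw [Real.dist_eq, dist_eq_norm] at h1
      rw [← mul_sub, abs_mul, abs_of_nonneg (M i).coe_nonneg]
      exact h1.trans (mul_le_mul_of_nonneg_left hj (M i).coe_nonneg)
    have c := expect_norm_contraction (ι := S) (fun i t => h i (t.1.1 i))
      (fun i j t => (M i : ℝ) * t.1.1 i j) (fun i x y => hb i _ _)
      (fun i x => by simpa [h0] using hb i (x.1.1 i) 0) hm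
    have c' := ENNReal.ofReal_le_ofReal c
    rw [ENNReal.ofReal_mul (by norm_num), ENNReal.ofReal_sum_of_nonneg
      fun _ _ => Finset.expect_nonneg fun _ _ => norm_nonneg _] at c'
    simp only [← rademacherMean_enorm, enorm_pi_eq_iSup, ENNReal.ofReal_ofNat] at c'
    refine le_trans (rademacherMean_mono fun ε => ?_) (c'.trans ?_)
    · exact iSup₂_le fun t ht => le_iSup
        (fun x : S => ‖∑ i, ((ε i : ℤ) : ℝ) * h i (x.1.1 i)‖ₑ) ⟨t, ht⟩
    · gcongr with j
      refine rademacherMean_mono fun ε => iSup_le fun x => ?_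
      exact le_iSup₂ (f := fun t (_ : t ∈ T) => ‖∑ i, ((ε i : ℤ) : ℝ) * ((M i : ℝ) * t i j)‖ₑ)
        x.1.1 x.1.2
  refine le_trans (le_of_eq ?_) (iSup_le fin)
  -- The suprema over finite subsets are directed, so they commute with the finite sum over sign
  -- vectors.
  unfold rademacherMean
  rw [← ENNReal.iSup_div, ← ENNReal.finsetSum_iSup]
  · congr 1
    refine Finset.sum_congr rfl fun ε _ => ?_
    beta_reduce
    rw [iSup_subtype', iSup_eq_iSup_finset]
  · classical
    intro S S'
    exact ⟨S ∪ S', fun ε => ⟨biSup_mono fun t ht => Finset.mem_union_left _ ht,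
      biSup_mono fun t ht => Finset.mem_union_right _ ht⟩⟩

/-- Test case: one summand, `T` a single basis vector and `h` its coordinate, where both averages
equal `1`. The bound lets the factor `β_{2k}` in `constA` be discarded. -/
theorem one_le_betaConst {m : ℕ} (hm : 0 < m) : 1 ≤ betaConst m := by
  refine le_sInf fun β hβ => ?_
  have h := hβ 1 {fun _ => Pi.single ⟨0, hm⟩ 1} (fun _ => 1) (fun _ t => t ⟨0, hm⟩)
    Bornology.isBounded_singleton (fun _ => LipschitzWith.eval _) (fun _ => rfl)
  have e1 : ∀ ε : Fin 1 → ℤˣ, ‖((ε 0 : ℤ) : ℝ)‖ₑ = 1 := by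
    intro ε
    rw [← ofReal_norm, Real.norm_eq_abs, abs_intUnit, ENNReal.ofReal_one]
  have e2 : rademacherMean 1 (fun _ => 1) = 1 := by
    simp [rademacherMean, ENNReal.div_self]
  rw [Finset.sum_eq_single (⟨0, hm⟩ : Fin m)] at h
  · simpa [e1, e2] using h
  · intro j _ hj
    simp [hj, rademacherMean]
  · simp

theorem betaConst_le_two {m : ℕ} (hm : 0 < m) : betaConst m ≤ 2 :=
  sInf_le (isComparisonConstant_two hm)

theorem betaConst_two_mul_le {k : ℕ} (hk : 0 < k) :
    betaConst (2 * k) ≤ ((3 ^ (2 * k) + 3 ^ (2 * k - 1) - 2 ^ (2 * k) : ℕ) : ℝ≥0∞) := by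
  refine (betaConst_le_two (by omega)).trans ?_
  have h1 : 2 ^ (2 * k) ≤ 3 ^ (2 * k) := Nat.pow_le_pow_left (by norm_num) _
  have h2 : 3 ^ 1 ≤ 3 ^ (2 * k - 1) := Nat.pow_le_pow_right (by norm_num) (by omega)
  have h3 : 2 ≤ 3 ^ (2 * k) + 3 ^ (2 * k - 1) - 2 ^ (2 * k) := by omega
  exact_mod_cast h3

/-! ### McDiarmid's inequality. -/

section Product

variable {α : Type*} [MeasurableSpace α]

theorem integrable_of_abs_le {Ω : Type*} [MeasurableSpace Ω] {μ : Measure Ω} [IsFiniteMeasure μ]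
    {E : Type*} [NormedAddCommGroup E] [MeasurableSpace E] [BorelSpace E]
    [SecondCountableTopology E] {f : Ω → E} (hf : Measurable f) {B : ℝ} (hB : ∀ ω, ‖f ω‖ ≤ B) :
    Integrable f μ :=
  Integrable.of_bound hf.aestronglyMeasurable B (Filter.Eventually.of_forall hB)

/-- Hoeffding's lemma for a function of oscillation at most `c`. -/
theorem hasSubgaussianMGF_of_oscillation (μ : Measure α) [IsProbabilityMeasure μ] {f : α → ℝ}
    (hf : Measurable f) {c : ℝ≥0} (hc : ∀ a b, |f a - f b| ≤ c) :
    HasSubgaussianMGF (fun a => f a - ∫ b, f b ∂μ) ((c / 2) ^ 2) μ := by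
  have hne : Nonempty α := nonempty_of_isProbabilityMeasure μ
  obtain ⟨a₀⟩ := hne
  have hbdd : BddBelow (Set.range f) := by
    refine ⟨f a₀ - c, ?_⟩
    rintro _ ⟨a, rfl⟩
    linarith [(abs_le.1 (hc a a₀)).1]
  have h := hasSubgaussianMGF_of_mem_Icc (μ := μ) (X := f) (a := ⨅ a, f a) (b := (⨅ a, f a) + c)
    hf.aemeasurable (Filter.Eventually.of_forall fun a => ⟨ciInf_le hbdd a, ?_⟩)
  · simpa using h
  · have : Nonempty α := ⟨a₀⟩
    have : f a - c ≤ ⨅ a, f a := le_ciInf fun b => by linarith [(abs_le.1 (hc a b)).2]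
    linarith

/-- **McDiarmid's inequality**: a function with bounded differences of independent variables is
sub-Gaussian around its mean. -/
theorem hasSubgaussianMGF_of_boundedDifferences {N : ℕ} (μ : Fin N → Measure α)
    [∀ i, IsProbabilityMeasure (μ i)] {f : (Fin N → α) → ℝ} (hf : Measurable f) {B : ℝ}
    (hB : ∀ y, ‖f y‖ ≤ B) {c : Fin N → ℝ≥0}
    (hc : ∀ i y a, |f (Function.update y i a) - f y| ≤ c i) :
    HasSubgaussianMGF (fun y => f y - ∫ z, f z ∂Measure.pi μ) (∑ i, (c i / 2) ^ 2)
      (Measure.pi μ) := by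
  induction N generalizing B with
  | zero =>
    have h : (fun y => f y - ∫ z, f z ∂Measure.pi μ) = fun _ => 0 := by
      funext y
      have : f = fun _ => f y := funext fun z => by rw [Subsingleton.elim z y]
      rw [this]; simp
    rw [h]
    simp
  | succ N ih =>
    set ν := Measure.pi fun i : Fin N => μ i.succ with hν
    have hmp : MeasurePreserving (fun z : α × (Fin N → α) => (Fin.cons z.1 z.2 : Fin (N + 1) → α))
        ((μ 0).prod ν) (Measure.pi μ) := by
      have h := (measurePreserving_piFinSuccAbove μ 0).symm
      simpa [MeasurableEquiv.piFinSuccAbove, Fin.insertNthEquiv, Fin.insertNth_zero] using h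
    have hcons := hmp.measurable
    have hfc : Measurable fun z : α × (Fin N → α) => f (Fin.cons z.1 z.2) := hf.comp hcons
    have tr : ∀ {F : (Fin (N + 1) → α) → ℝ} (C : ℝ), Measurable F → (∀ y, ‖F y‖ ≤ C) →
        ∫ y, F y ∂Measure.pi μ = ∫ y, ∫ a, F (Fin.cons a y) ∂μ 0 ∂ν := by
      intro F C hF hC
      rw [← hmp.map_eq, integral_map hcons.aemeasurable hF.aestronglyMeasurable]
      exact integral_prod_symm _ (integrable_of_abs_le (hF.comp hcons) fun z => hC _)
    -- Averaging out the first coordinate keeps the other bounded differences. In `f - E f = (f - g)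
    -- + (g - E g)`, Hoeffding's lemma in the first coordinate handles the first part and induction
    -- the second.
    set g : (Fin N → α) → ℝ := fun y => ∫ a, f (Fin.cons a y) ∂μ 0 with hg
    have hsec : ∀ y, Measurable fun a => f (Fin.cons a y) := fun y =>
      hfc.comp (measurable_id.prodMk measurable_const)
    have hint : ∀ y, Integrable (fun a => f (Fin.cons a y)) (μ 0) := fun y =>
      integrable_of_abs_le (hsec y) fun a => hB _
    have hgm : Measurable g :=
      (hfc.comp measurable_swap).stronglyMeasurable.integral_prod_right'.measurable
    have hgB : ∀ y, ‖g y‖ ≤ B := fun y => by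
      simpa using norm_integral_le_of_norm_le_const (μ := μ 0)
        (Filter.Eventually.of_forall fun a => hB (Fin.cons a y))
    have hgc : ∀ (i : Fin N) y a, |g (Function.update y i a) - g y| ≤ c i.succ := by
      intro i y a
      rw [hg]
      beta_reduce
      rw [← integral_sub (hint _) (hint _), ← Real.norm_eq_abs]
      refine (norm_integral_le_of_norm_le_const (C := c i.succ)
        (Filter.Eventually.of_forall fun b => ?_)).trans (by simp)
      rw [Fin.cons_update]
      exact hc i.succ (Fin.cons b y) a
    have hEf : ∫ z, f z ∂Measure.pi μ = ∫ y, g y ∂ν := tr B hf hB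
    have IH := ih (fun i => μ i.succ) hgm hgB hgc
    have hB' : ∀ y, |f y - ∫ z, f z ∂Measure.pi μ| ≤ B + B := by
      intro y
      have h1 : ‖∫ z, f z ∂Measure.pi μ‖ ≤ B := by
        simpa using norm_integral_le_of_norm_le_const (μ := Measure.pi μ)
          (Filter.Eventually.of_forall hB)
      exact (norm_sub_le _ _).trans (add_le_add (hB y) h1)
    have hexpB : ∀ t y, ‖Real.exp (t * (f y - ∫ z, f z ∂Measure.pi μ))‖
        ≤ Real.exp (|t| * (B + B)) := by
      intro t y
      rw [Real.norm_eq_abs, Real.abs_exp, Real.exp_le_exp]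
      calc _ ≤ |t * (f y - ∫ z, f z ∂Measure.pi μ)| := le_abs_self _
        _ ≤ _ := by rw [abs_mul]; exact mul_le_mul_of_nonneg_left (hB' y) (abs_nonneg t)
    have hexpm : ∀ t : ℝ, Measurable fun y => Real.exp (t * (f y - ∫ z, f z ∂Measure.pi μ)) :=
      fun t => by fun_prop
    refine ⟨fun t => integrable_of_abs_le (hexpm t) (hexpB t), fun t => ?_⟩
    rw [mgf, tr _ (hexpm t) (hexpB t), Fin.sum_univ_succ]
    have hH : ∀ y, mgf (fun a => f (Fin.cons a y) - g y) (μ 0) t ≤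
        Real.exp (((c 0 / 2) ^ 2 : ℝ≥0) * t ^ 2 / 2) := by
      intro y
      refine (hasSubgaussianMGF_of_oscillation (μ 0) (hsec y) (c := c 0) fun a b => ?_).mgf_le t
      have := hc 0 (Fin.cons b y) a
      rwa [Fin.update_cons_zero] at this
    have e1 : ∀ y, ∫ a, Real.exp (t * (f (Fin.cons a y) - ∫ z, f z ∂Measure.pi μ)) ∂μ 0 =
        mgf (fun a => f (Fin.cons a y) - g y) (μ 0) t *
          Real.exp (t * (g y - ∫ z, g z ∂ν)) := by
      intro y
      rw [mgf, ← integral_mul_const]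
      congr 1
      funext a
      rw [← Real.exp_add, hEf]
      congr 1
      ring
    simp only [e1]
    calc ∫ y, mgf (fun a => f (Fin.cons a y) - g y) (μ 0) t * Real.exp (t * (g y - ∫ z, g z ∂ν)) ∂ν
        ≤ ∫ y, Real.exp (((c 0 / 2) ^ 2 : ℝ≥0) * t ^ 2 / 2)
            * Real.exp (t * (g y - ∫ z, g z ∂ν)) ∂ν := by
          refine integral_mono_of_nonneg (Filter.Eventually.of_forall fun y => ?_)
            ((IH.integrable_exp_mul t).const_mul _) (Filter.Eventually.of_forall fun y => ?_)
          · exact mul_nonneg mgf_nonneg (Real.exp_pos _).le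
          · exact mul_le_mul_of_nonneg_right (hH y) (Real.exp_pos _).le
      _ = Real.exp (((c 0 / 2) ^ 2 : ℝ≥0) * t ^ 2 / 2) * mgf (fun y => g y - ∫ z, g z ∂ν) ν t := by
          rw [integral_const_mul]; rfl
      _ ≤ Real.exp (((c 0 / 2) ^ 2 : ℝ≥0) * t ^ 2 / 2)
            * Real.exp ((∑ i : Fin N, (c i.succ / 2) ^ 2 : ℝ≥0) * t ^ 2 / 2) :=
          mul_le_mul_of_nonneg_left (IH.mgf_le t) (Real.exp_pos _).le
      _ = _ := by
          rw [← Real.exp_add]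
          congr 1
          push_cast
          ring

/-- Upper tail of a sub-Gaussian variable, also for the degenerate variance proxy `0`. -/
theorem measure_lt_le_of_hasSubgaussianMGF {Ω : Type*} [MeasurableSpace Ω] {P : Measure Ω}
    [IsProbabilityMeasure P] {X : Ω → ℝ} {c : ℝ≥0} (hX : HasSubgaussianMGF X c P) {s L : ℝ}
    (hs : 0 ≤ s) (hcs : 2 * c * L ≤ s ^ 2) :
    P {ω | s < X ω} ≤ ENNReal.ofReal (Real.exp (-L)) := by
  -- For `c = 0` the Chernoff exponent divides by zero and yields only the bound `1`. But then `X =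
  -- 0` almost surely, and the strict inequality `s < 0` fails.
  rcases eq_or_ne c 0 with rfl | h0
  · have h := hX.ae_eq_zero_of_hasSubgaussianMGF_zero
    have : P {ω | s < X ω} = 0 := by
      refine measure_mono_null ?_ h
      intro ω hω h1
      change s < X ω at hω
      rw [h1] at hω
      exact absurd hω (not_lt.2 hs)
    rw [this]; exact zero_le
  · have hc : (0 : ℝ) < c := by exact_mod_cast pos_iff_ne_zero.2 h0
    have h := hX.measure_ge_le hs
    have h1 : P {ω | s < X ω} ≤ P {ω | s ≤ X ω} := measure_mono fun ω (hω : s < X ω) => hω.le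
    refine h1.trans ?_
    rw [← ENNReal.ofReal_toReal (measure_ne_top P {ω | s ≤ X ω})]
    refine ENNReal.ofReal_le_ofReal (h.trans (Real.exp_le_exp.2 ?_))
    rw [div_le_iff₀ (by positivity)]
    linarith

end Product

/-! ### Symmetrization by an independent copy. -/

section Symmetrization

variable {α : Type*} [MeasurableSpace α] {E : Type*} [NormedAddCommGroup E] [NormedSpace ℝ E]
  [MeasurableSpace E] [BorelSpace E] [SecondCountableTopology E] [CompleteSpace E]

/-- Symmetrization: if all Rademacher averages are at most `K`, then the mean norm of the centered
sum is at most `2 K`. -/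
theorem integral_norm_centered_sum_le {N : ℕ} (μ : Fin N → Measure α)
    [∀ i, IsProbabilityMeasure (μ i)] {X : Fin N → α → E} (hX : ∀ i, Measurable (X i)) {B : ℝ}
    (hB : ∀ i a, ‖X i a‖ ≤ B) {K : ℝ}
    (hK : ∀ y : Fin N → α, 𝔼 ε : Fin N → ℤˣ, ‖∑ i, ((ε i : ℤ) : ℝ) • X i (y i)‖ ≤ K) :
    ∫ y, ‖∑ i, (X i (y i) - ∫ a, X i a ∂μ i)‖ ∂Measure.pi μ ≤ 2 * K := by
  set π := Measure.pi μ
  let S : (Fin N → α) → E := fun y => ∑ i, X i (y i)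
  have hS : Measurable S := Finset.measurable_sum _ fun i _ => (hX i).comp (measurable_pi_apply i)
  have hSB : ∀ y, ‖S y‖ ≤ ∑ _i : Fin N, B := fun y =>
    (norm_sum_le _ _).trans (Finset.sum_le_sum fun i _ => hB i _)
  have hSint : Integrable S π := integrable_of_abs_le hS hSB
  have hES : ∫ y, S y ∂π = ∑ i, ∫ a, X i a ∂μ i := by
    have hi : ∀ i ∈ Finset.univ, Integrable (fun y : Fin N → α => X i (y i)) π := fun i _ =>
      integrable_of_abs_le ((hX i).comp (measurable_pi_apply i)) fun y => hB i (y i)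
    rw [integral_finsetSum _ hi]
    exact Finset.sum_congr rfl fun i _ => integral_comp_eval (hX i).aestronglyMeasurable
  have hdm : Measurable fun z : (Fin N → α) × (Fin N → α) => ‖S z.1 - S z.2‖ :=
    ((hS.comp measurable_fst).sub (hS.comp measurable_snd)).norm
  have hdB : ∀ z : (Fin N → α) × (Fin N → α),
      ‖‖S z.1 - S z.2‖‖ ≤ (∑ _i : Fin N, B) + ∑ _i : Fin N, B := fun z => by
    rw [norm_norm]
    exact (norm_sub_le _ _).trans (add_le_add (hSB _) (hSB _))
  have hdint : Integrable (fun z : (Fin N → α) × (Fin N → α) => ‖S z.1 - S z.2‖) (π.prod π) :=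
    integrable_of_abs_le hdm hdB
  -- The expectation is written as the integral of `S` over an independent copy and taken out of the
  -- norm.
  have step1 : ∫ y, ‖∑ i, (X i (y i) - ∫ a, X i a ∂μ i)‖ ∂π ≤
      ∫ z, ‖S z.1 - S z.2‖ ∂π.prod π := by
    rw [integral_prod _ hdint]
    refine integral_mono_of_nonneg (Filter.Eventually.of_forall fun y => norm_nonneg _)
      hdint.integral_prod_left (Filter.Eventually.of_forall fun y => ?_)
    have e : ∑ i, (X i (y i) - ∫ a, X i a ∂μ i) = ∫ y', (S y - S y') ∂π := by
      rw [integral_sub (integrable_const _) hSint, hES, Finset.sum_sub_distrib]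
      simp [S]
    beta_reduce
    rw [e]
    exact norm_integral_le_integral_norm _
  -- Swapping `y_i` with its copy preserves the product law and changes the sign of the `i`-th
  -- difference; this inserts arbitrary signs.
  let sw : ℤˣ → α × α → α × α := fun e => if e = 1 then id else Prod.swap
  have sw_sub : ∀ (e : ℤˣ) (G : α → E) z,
      G (sw e z).1 - G (sw e z).2 = ((e : ℤ) : ℝ) • (G z.1 - G z.2) := by
    intro e G z
    rcases Int.units_eq_one_or e with h | h
    · simp [sw, h]
    · have : (-1 : ℤˣ) ≠ 1 := by decide
      simp [sw, h, this]
  have sw_mp : ∀ e i, MeasurePreserving (sw e) ((μ i).prod (μ i)) ((μ i).prod (μ i)) := by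
    intro e i
    by_cases h : e = 1
    · simpa only [sw, h, if_true] using MeasurePreserving.id _
    · simpa only [sw, h, if_false] using Measure.measurePreserving_swap
  have harrow := measurePreserving_arrowProdEquivProdArrow α α (Fin N) μ μ
  have hpair : ∀ {G : (Fin N → α × α) → ℝ} (F : (Fin N → α) × (Fin N → α) → ℝ),
      (∀ z, G z = F (fun i => (z i).1, fun i => (z i).2)) →
      ∫ z, G z ∂(Measure.pi fun i => (μ i).prod (μ i)) = ∫ z, F z ∂π.prod π := by
    intro G F h
    rw [← harrow.integral_comp']
    exact integral_congr_ae (Filter.Eventually.of_forall h)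
  have step2 : ∀ ε : Fin N → ℤˣ, ∫ z, ‖S z.1 - S z.2‖ ∂π.prod π =
      ∫ z, ‖∑ i, ((ε i : ℤ) : ℝ) • X i (z.1 i) - ∑ i, ((ε i : ℤ) : ℝ) • X i (z.2 i)‖ ∂π.prod π := by
    intro ε
    rw [← hpair (G := fun z => ‖S (fun i => (z i).1) - S (fun i => (z i).2)‖) _ fun z => rfl,
      ← hpair (G := fun z => ‖S (fun i => (sw (ε i) (z i)).1) - S (fun i => (sw (ε i) (z i)).2)‖) _
        fun z => ?_]
    · have hm := measurePreserving_pi _ _ fun i => sw_mp (ε i) i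
      rw [← hm.map_eq, integral_map hm.measurable.aemeasurable]
      · rw [hm.map_eq]
      · refine Measurable.aestronglyMeasurable ?_
        exact hdm.comp (harrow.measurable)
    · congr 1
      simp only [S]
      rw [← Finset.sum_sub_distrib, ← Finset.sum_sub_distrib]
      exact Finset.sum_congr rfl fun i _ => by rw [sw_sub, smul_sub]
  have hTm : ∀ ε : Fin N → ℤˣ, Measurable fun y : Fin N → α =>
      ∑ i, ((ε i : ℤ) : ℝ) • X i (y i) := fun ε =>
    Finset.measurable_sum _ fun i _ => ((hX i).comp (measurable_pi_apply i)).const_smul _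
  have hTB : ∀ (ε : Fin N → ℤˣ) (y : Fin N → α),
      ‖∑ i, ((ε i : ℤ) : ℝ) • X i (y i)‖ ≤ ∑ _i : Fin N, B := fun ε y => by
    refine (norm_sum_le _ _).trans (Finset.sum_le_sum fun i _ => ?_)
    rw [norm_smul, Real.norm_eq_abs, abs_intUnit, one_mul]
    exact hB i _
  have hTint : ∀ ε : Fin N → ℤˣ, Integrable (fun z : (Fin N → α) × (Fin N → α) =>
      ‖∑ i, ((ε i : ℤ) : ℝ) • X i (z.1 i) - ∑ i, ((ε i : ℤ) : ℝ) • X i (z.2 i)‖) (π.prod π) :=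
    fun ε => integrable_of_abs_le
      (((hTm ε).comp measurable_fst).sub ((hTm ε).comp measurable_snd)).norm fun z => by
        rw [norm_norm]
        exact (norm_sub_le _ _).trans (add_le_add (hTB ε _) (hTB ε _))
  calc _ ≤ ∫ z, ‖S z.1 - S z.2‖ ∂π.prod π := step1
    _ = 𝔼 ε : Fin N → ℤˣ, ∫ z, ‖∑ i, ((ε i : ℤ) : ℝ) • X i (z.1 i)
          - ∑ i, ((ε i : ℤ) : ℝ) • X i (z.2 i)‖ ∂π.prod π := by
        rw [← Finset.expect_congr rfl fun ε _ => step2 ε, Fintype.expect_const]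
    _ = ∫ z, 𝔼 ε : Fin N → ℤˣ, ‖∑ i, ((ε i : ℤ) : ℝ) • X i (z.1 i)
          - ∑ i, ((ε i : ℤ) : ℝ) • X i (z.2 i)‖ ∂π.prod π := by
        simp only [Fintype.expect_eq_sum_div_card]
        rw [integral_div, integral_finsetSum _ fun ε _ => hTint ε]
    _ ≤ ∫ _z : (Fin N → α) × (Fin N → α), 2 * K ∂π.prod π := by
        refine integral_mono ?_ (integrable_const _) fun z => ?_
        · simp only [Fintype.expect_eq_sum_div_card]
          exact (integrable_finsetSum _ fun ε _ => hTint ε).div_const _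
        · refine (Finset.expect_le_expect fun ε _ => norm_sub_le _ _).trans ?_
          rw [Finset.expect_add_distrib, two_mul]
          exact add_le_add (hK z.1) (hK z.2)
    _ = 2 * K := by simp

end Symmetrization

/-! ### Derivatives of the centered loss, and Rademacher averages of the gradient increments. -/

section Calculus

variable {Ω 𝒴 : Type*} [MeasurableSpace Ω] {N k p : ℕ}

/-- The partial derivative `∂_j γ_i(Z_i w, y)`. -/
noncomputable def gradAt (γ : Fin N → (Fin k → ℝ) → 𝒴 → ℝ) (Z : Fin N → Matrix (Fin k) (Fin p) ℝ)
    (i : Fin N) (j : Fin k) (w : Fin p → ℝ) (y : 𝒴) : ℝ :=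
  partialDeriv j (fun x => γ i x y) (Z i *ᵥ w)

/-- The `h`-th coordinate of the difference of the gradients of the centered loss at `w`, `θ`. -/
noncomputable def gradIncrement (P : Measure Ω) (γ : Fin N → (Fin k → ℝ) → 𝒴 → ℝ) (Y : Fin N → Ω → 𝒴)
    (Z : Fin N → Matrix (Fin k) (Fin p) ℝ) (θ w : Fin p → ℝ) (h : Fin p) (ω : Ω) : ℝ :=
  linearTerm P γ Y Z w (Pi.single h 1) ω - linearTerm P γ Y Z θ (Pi.single h 1) ω

theorem fderiv_apply_eq_sum_partialDeriv (f : (Fin k → ℝ) → ℝ) (t v : Fin k → ℝ) :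
    fderiv ℝ f t v = ∑ j, partialDeriv j f t * v j := by
  conv_lhs => rw [← Finset.univ_sum_single v]
  rw [map_sum]
  refine Finset.sum_congr rfl fun j _ => ?_
  have : (Pi.single j (v j) : Fin k → ℝ) = v j • Pi.single j 1 := by
    rw [← Pi.single_smul, smul_eq_mul, mul_one]
  rw [this, map_smul, smul_eq_mul, mul_comm, partialDeriv]

theorem linearTerm_eq_sum (P : Measure Ω) (γ : Fin N → (Fin k → ℝ) → 𝒴 → ℝ) (Y : Fin N → Ω → 𝒴)
    (Z : Fin N → Matrix (Fin k) (Fin p) ℝ) (θ d : Fin p → ℝ) (ω : Ω) :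
    linearTerm P γ Y Z θ d ω = ∑ h, linearTerm P γ Y Z θ (Pi.single h 1) ω * d h := by
  unfold linearTerm
  simp only [dotProduct_single, mul_one, Finset.sum_mul]
  symm
  rw [Finset.sum_comm]
  refine Finset.sum_congr rfl fun i _ => ?_
  rw [Finset.sum_comm]
  refine Finset.sum_congr rfl fun j _ => ?_
  simp only [dotProduct, Finset.mul_sum, mul_assoc]

theorem abs_sum_mul_le {ι : Type*} [Fintype ι] {f d : ι → ℝ} {C : ℝ} (hf : ∀ h, |f h| ≤ C) :
    |∑ h, f h * d h| ≤ C * ∑ h, |d h| := by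
  rw [Finset.mul_sum]
  refine (Finset.abs_sum_le_sum_abs _ _).trans (Finset.sum_le_sum fun h _ => ?_)
  rw [abs_mul]
  exact mul_le_mul_of_nonneg_right (hf h) (abs_nonneg _)

variable {P : Measure Ω} {Y : Fin N → Ω → 𝒴}
  {Z : Fin N → Matrix (Fin k) (Fin p) ℝ} {γ : Fin N → (Fin k → ℝ) → 𝒴 → ℝ} {f₁ f₂ : ℝ}
  {θ : Fin p → ℝ}

theorem linearTerm_single (w : Fin p → ℝ) (h : Fin p) (ω : Ω) :
    linearTerm P γ Y Z w (Pi.single h 1) ω =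
      ∑ i, ∑ j, (gradAt γ Z i j w (Y i ω) - ∫ ω', gradAt γ Z i j w (Y i ω') ∂P) * Z i j h := by
  simp [linearTerm, centered, gradAt]

theorem hasDerivAt_loss (hγdiff : ∀ i y, Differentiable ℝ (fun t => γ i t y)) (i : Fin N)
    (v d : Fin p → ℝ) (y : 𝒴) (s : ℝ) :
    HasDerivAt (fun s : ℝ => γ i (Z i *ᵥ (v + s • d)) y)
      (∑ j, gradAt γ Z i j (v + s • d) y * (Z i j ⬝ᵥ d)) s := by
  have h1 : HasDerivAt (fun s : ℝ => Z i *ᵥ (v + s • d)) (Z i *ᵥ d) s := by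
    have h2 : (fun s : ℝ => Z i *ᵥ (v + s • d)) = fun s : ℝ => Z i *ᵥ v + s • (Z i *ᵥ d) := by
      funext s
      rw [Matrix.mulVec_add, Matrix.mulVec_smul]
    rw [h2]
    simpa using ((hasDerivAt_id s).smul_const (Z i *ᵥ d)).const_add (Z i *ᵥ v)
  have h3 := (hγdiff i y (Z i *ᵥ (v + s • d))).hasFDerivAt.comp_hasDerivAt s h1
  rw [fderiv_apply_eq_sum_partialDeriv] at h3
  exact h3

theorem abs_deriv_loss_le (hf₁ : ∀ i j s y, |partialDeriv j (fun x => γ i x y) s| ≤ f₁)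
    (i : Fin N) (w d : Fin p → ℝ) (y : 𝒴) :
    ‖∑ j, gradAt γ Z i j w y * (Z i j ⬝ᵥ d)‖ ≤ f₁ * ∑ j, |Z i j ⬝ᵥ d| :=
  abs_sum_mul_le fun j => hf₁ i j _ y

theorem abs_sum_gradAt_sub_le
    (hf₂ : ∀ i j s t y, |partialDeriv j (fun x => γ i x y) s - partialDeriv j (fun x => γ i x y) t|
      ≤ f₂ * ‖s - t‖) (hf₂0 : 0 ≤ f₂) {M : ℝ} (hM : ∀ i j h, |Z i j h| ≤ M) (i : Fin N) (h : Fin p)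
    (w w' : Fin p → ℝ) (y : 𝒴) :
    |∑ j, (gradAt γ Z i j w y - gradAt γ Z i j w' y) * Z i j h| ≤
      k * f₂ * M * ‖Z i *ᵥ (w - w')‖ := by
  refine (abs_sum_mul_le fun j => hf₂ i j _ _ y).trans ?_
  rw [← Matrix.mulVec_sub]
  have h1 : ∑ j, |Z i j h| ≤ k * M := by
    simpa using Finset.sum_le_card_nsmul Finset.univ _ M fun j _ => hM i j h
  have h2 := mul_le_mul_of_nonneg_left h1 (mul_nonneg hf₂0 (norm_nonneg (Z i *ᵥ (w - w'))))
  linarith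

/-- The Rademacher averages of the gradient increments over a finite set in an `ℓ₁` ball. -/
theorem expect_norm_gradIncrement_le (hk : 0 < k) (hp : 0 < p)
    (hf₂ : ∀ i j s t y, |partialDeriv j (fun x => γ i x y) s - partialDeriv j (fun x => γ i x y) t|
      ≤ f₂ * ‖s - t‖) (hf₂0 : 0 ≤ f₂) {M : ℝ} (hM0 : 0 ≤ M) (hM : ∀ i j h, |Z i j h| ≤ M) {R : ℝ}
    {W : Finset (Fin p → ℝ)} (hW : ∀ w ∈ W, ∑ l, |(w - θ) l| ≤ R) (hR : 0 ≤ R) {V : Fin k → ℝ}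
    (hV : ∀ j h, ∑ i, Z i j h ^ 2 ≤ V j) (h : Fin p) (y : Fin N → 𝒴) :
    𝔼 ε : Fin N → ℤˣ, ‖∑ i, ((ε i : ℤ) : ℝ) • (fun w : W =>
        ∑ j, (gradAt γ Z i j w.1 (y i) - gradAt γ Z i j θ (y i)) * Z i j h)‖ ≤
      2 * ∑ j, k * f₂ * M * R * (√2 * √(Real.log (2 * p)) * √(V j)) := by
  set c := k * f₂ * M with hc
  have hc0 : 0 ≤ c := by positivity
  let a : Fin N → W → ℝ := fun i w =>
    ∑ j, (gradAt γ Z i j w.1 (y i) - gradAt γ Z i j θ (y i)) * Z i j h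
  -- The increments of `a i` are at most `c` times the sup norm of `Z_i(w - w')`, which some
  -- coordinate attains; so the contraction is needed in dimension `k` only.
  let b : Fin N → Fin k → W → ℝ := fun i j w => c * (Z i *ᵥ (w.1 - θ)) j
  have hsum : ∀ ε : Fin N → ℤˣ, ∑ i, ((ε i : ℤ) : ℝ) • a i
      = fun w => ∑ i, ((ε i : ℤ) : ℝ) * a i w := by
    intro ε; funext w; simp
  have hex : ∀ i (w w' : Fin p → ℝ), ∃ j,
      |∑ j, (gradAt γ Z i j w (y i) - gradAt γ Z i j w' (y i)) * Z i j h| ≤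
        |c * (Z i *ᵥ (w - w')) j| := by
    intro i w w'
    obtain ⟨j, hj⟩ := exists_norm_le_abs_apply hk (Z i *ᵥ (w - w'))
    refine ⟨j, ?_⟩
    rw [abs_mul, abs_of_nonneg hc0]
    exact (abs_sum_gradAt_sub_le hf₂ hf₂0 hM i h w w' (y i)).trans
      (mul_le_mul_of_nonneg_left hj hc0)
  have contr := expect_norm_contraction a b
    (fun i w w' => by
      obtain ⟨j, hj⟩ := hex i w.1 w'.1
      refine ⟨j, ?_⟩
      have e1 : a i w - a i w'
          = ∑ j, (gradAt γ Z i j w.1 (y i) - gradAt γ Z i j w'.1 (y i)) * Z i j h := by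
        simp only [a]
        rw [← Finset.sum_sub_distrib]
        exact Finset.sum_congr rfl fun j _ => by ring
      have e2 : b i j w - b i j w' = c * (Z i *ᵥ (w.1 - w'.1)) j := by
        simp only [b, Matrix.mulVec_sub, Pi.sub_apply]
        ring
      rw [e1, e2]
      exact hj)
    (fun i w => hex i w.1 θ) hk
  simp only [a] at hsum contr
  simp only [hsum]
  refine contr.trans (mul_le_mul_of_nonneg_left (Finset.sum_le_sum fun j _ => ?_) two_pos.le)
  -- `ℓ₁`-`ℓ_∞` duality: the supremum over `w` becomes a maximum over the `p` columns, at the cost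
  -- of the radius `R`.
  have h1 : ∀ ε : Fin N → ℤˣ, ‖fun w => ∑ i, ((ε i : ℤ) : ℝ) * b i j w‖ ≤
      c * R * ‖fun l => ∑ i, ((ε i : ℤ) : ℝ) * Z i j l‖ := by
    intro ε
    refine (pi_norm_le_iff_of_nonneg (by positivity)).2 fun w => ?_
    have e : ∑ i, ((ε i : ℤ) : ℝ) * b i j w
        = c * ∑ l, (∑ i, ((ε i : ℤ) : ℝ) * Z i j l) * (w.1 - θ) l := by
      simp only [b, Matrix.mulVec, dotProduct, Finset.mul_sum, Finset.sum_mul]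
      rw [Finset.sum_comm]
      refine Finset.sum_congr rfl fun l _ => Finset.sum_congr rfl fun i _ => by ring
    rw [e, Real.norm_eq_abs, abs_mul, abs_of_nonneg hc0, mul_assoc c R]
    refine mul_le_mul_of_nonneg_left ?_ hc0
    refine (abs_sum_mul_le fun l =>
      norm_le_pi_norm (fun l => ∑ i, ((ε i : ℤ) : ℝ) * Z i j l) l).trans ?_
    rw [mul_comm]
    exact mul_le_mul_of_nonneg_right (hW w.1 w.2) (norm_nonneg _)
  refine (Finset.expect_le_expect fun ε _ => h1 ε).trans ?_
  rw [← Finset.mul_expect]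
  exact mul_le_mul_of_nonneg_left (expect_norm_rademacher_le hp (fun i l => Z i j l) (hV j))
    (by positivity)

variable [MeasurableSpace 𝒴]

/-- The derivative is a pointwise limit of difference quotients, each measurable in `y`. -/
theorem measurable_partialDeriv {g : (Fin k → ℝ) → 𝒴 → ℝ} (hm : ∀ t, Measurable (g t))
    (hd : ∀ y, Differentiable ℝ fun t => g t y) (j : Fin k) (t : Fin k → ℝ) :
    Measurable fun y => partialDeriv j (fun x => g x y) t := by
  refine measurable_of_tendsto_metrizable' (nhdsWithin (0 : ℝ) {0}ᶜ)
    (f := fun s y => s⁻¹ • (g (t + s • Pi.single j 1) y - g t y)) (fun s => ?_) ?_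
  · exact (((hm _).sub (hm _)).const_mul s⁻¹ :)
  · rw [tendsto_pi_nhds]
    intro y
    exact (hd y t).hasFDerivAt.hasLineDerivAt (Pi.single j 1) |>.tendsto_slope_zero

theorem measurable_gradAt (hγmeas : ∀ i t, Measurable (γ i t))
    (hγdiff : ∀ i y, Differentiable ℝ (fun t => γ i t y)) (i : Fin N) (j : Fin k)
    (w : Fin p → ℝ) : Measurable (gradAt γ Z i j w) :=
  measurable_partialDeriv (hγmeas i) (hγdiff i) j _

theorem measurable_centeredLoss (hY : ∀ i, Measurable (Y i)) (hγmeas : ∀ i t, Measurable (γ i t))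
    (u : Fin p → ℝ) : Measurable (centeredLoss P γ Y Z u) :=
  Finset.measurable_sum _ fun i _ => ((hγmeas i _).comp (hY i)).sub_const _

theorem measurable_linearTerm (hY : ∀ i, Measurable (Y i)) (hγmeas : ∀ i t, Measurable (γ i t))
    (hγdiff : ∀ i y, Differentiable ℝ (fun t => γ i t y)) (d : Fin p → ℝ) :
    Measurable (linearTerm P γ Y Z θ d) :=
  Finset.measurable_sum _ fun i _ => Finset.measurable_sum _ fun j _ =>
    (((measurable_gradAt hγmeas hγdiff i j θ).comp (hY i)).sub_const _).mul_const _

variable [IsProbabilityMeasure P]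

theorem integrable_gradAt (hY : ∀ i, Measurable (Y i)) (hγmeas : ∀ i t, Measurable (γ i t))
    (hγdiff : ∀ i y, Differentiable ℝ (fun t => γ i t y))
    (hf₁ : ∀ i j s y, |partialDeriv j (fun x => γ i x y) s| ≤ f₁) (i : Fin N) (j : Fin k)
    (w : Fin p → ℝ) : Integrable (fun ω => gradAt γ Z i j w (Y i ω)) P :=
  integrable_of_abs_le ((measurable_gradAt hγmeas hγdiff i j w).comp (hY i)) fun _ => hf₁ i j _ _

/-- Serves to replace the ball by a countable dense subset. The expectations are continuous by
dominated convergence. -/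
theorem continuous_gradIncrement (hY : ∀ i, Measurable (Y i))
    (hγmeas : ∀ i t, Measurable (γ i t)) (hγdiff : ∀ i y, Differentiable ℝ (fun t => γ i t y))
    (hf₁ : ∀ i j s y, |partialDeriv j (fun x => γ i x y) s| ≤ f₁)
    (hf₂ : ∀ i j s t y, |partialDeriv j (fun x => γ i x y) s - partialDeriv j (fun x => γ i x y) t|
      ≤ f₂ * ‖s - t‖) (h : Fin p) (ω : Ω) :
    Continuous fun w => gradIncrement P γ Y Z θ w h ω := by
  have hc : ∀ i j y, Continuous fun w : Fin p → ℝ => gradAt γ Z i j w y := by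
    intro i j y
    have h1 : Continuous fun s => partialDeriv j (fun x => γ i x y) s := by
      refine (LipschitzWith.of_dist_le_mul (K := f₂.toNNReal) fun s t => ?_).continuous
      rw [Real.dist_eq, dist_eq_norm]
      exact (hf₂ i j s t y).trans
        (mul_le_mul_of_nonneg_right (Real.le_coe_toNNReal f₂) (norm_nonneg _))
    exact h1.comp (continuous_const.matrix_mulVec continuous_id)
  simp only [gradIncrement, linearTerm_single]
  refine Continuous.sub ?_ continuous_const
  refine continuous_finsetSum _ fun i _ => continuous_finsetSum _ fun j _ => ?_
  refine Continuous.mul (Continuous.sub (hc i j _) ?_) continuous_const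
  exact continuous_of_dominated (bound := fun _ => f₁)
    (fun w => ((measurable_gradAt hγmeas hγdiff i j w).comp (hY i)).aestronglyMeasurable)
    (fun w => Filter.Eventually.of_forall fun ω => hf₁ i j _ _) (integrable_const _)
    (Filter.Eventually.of_forall fun ω => hc i j _)

/-- Bounded derivatives make the loss at `w` differ boundedly from that at `θ`. This covers points
outside `D`, which the segments may visit. -/
theorem integrable_loss (hY : ∀ i, Measurable (Y i)) (hγmeas : ∀ i t, Measurable (γ i t))
    (hγdiff : ∀ i y, Differentiable ℝ (fun t => γ i t y))
    (hγint : ∀ i, Integrable (fun ω => γ i (Z i *ᵥ θ) (Y i ω)) P)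
    (hf₁ : ∀ i j s y, |partialDeriv j (fun x => γ i x y) s| ≤ f₁) (i : Fin N) (w : Fin p → ℝ) :
    Integrable (fun ω => γ i (Z i *ᵥ w) (Y i ω)) P := by
  have h1 : Integrable (fun ω => γ i (Z i *ᵥ w) (Y i ω) - γ i (Z i *ᵥ θ) (Y i ω)) P := by
    refine integrable_of_abs_le (((hγmeas i _).comp (hY i)).sub ((hγmeas i _).comp (hY i)))
      (B := f₁ * ∑ j, |Z i j ⬝ᵥ (w - θ)|) fun ω => ?_
    have h2 := norm_image_sub_le_of_norm_deriv_le_segment_01'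
      (fun s _ => (hasDerivAt_loss (Z := Z) hγdiff i θ (w - θ) (Y i ω) s).hasDerivWithinAt)
      (fun s _ => abs_deriv_loss_le hf₁ i _ _ _)
    simpa using h2
  have h3 := h1.add (hγint i)
  refine h3.congr (Filter.Eventually.of_forall fun ω => ?_)
  simp

theorem hasDerivAt_centeredLoss (hY : ∀ i, Measurable (Y i)) (hγmeas : ∀ i t, Measurable (γ i t))
    (hγdiff : ∀ i y, Differentiable ℝ (fun t => γ i t y))
    (hγint : ∀ i, Integrable (fun ω => γ i (Z i *ᵥ θ) (Y i ω)) P)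
    (hf₁ : ∀ i j s y, |partialDeriv j (fun x => γ i x y) s| ≤ f₁) (v d : Fin p → ℝ) (ω : Ω)
    (s : ℝ) :
    HasDerivAt (fun s : ℝ => centeredLoss P γ Y Z (v + s • d) ω)
      (linearTerm P γ Y Z (v + s • d) d ω) s := by
  unfold centeredLoss linearTerm
  refine HasDerivAt.fun_sum fun i _ => ?_
  have h1 := (hasDerivAt_integral_of_dominated_loc_of_deriv_le (μ := P) (x₀ := s)
    (F := fun s ω => γ i (Z i *ᵥ (v + s • d)) (Y i ω))
    (F' := fun s ω => ∑ j, gradAt γ Z i j (v + s • d) (Y i ω) * (Z i j ⬝ᵥ d))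
    (bound := fun _ => f₁ * ∑ j, |Z i j ⬝ᵥ d|) Filter.univ_mem
    (Filter.Eventually.of_forall fun s => ((hγmeas i _).comp (hY i)).aestronglyMeasurable)
    (integrable_loss hY hγmeas hγdiff hγint hf₁ i _)
    (Finset.measurable_sum _ fun j _ =>
      ((measurable_gradAt hγmeas hγdiff i j _).comp (hY i)).mul_const _).aestronglyMeasurable
    (Filter.Eventually.of_forall fun ω s _ => abs_deriv_loss_le hf₁ i _ _ _)
    (integrable_const _)
    (Filter.Eventually.of_forall fun ω s _ => hasDerivAt_loss hγdiff i v d _ s)).2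
  have h2 := (hasDerivAt_loss (Z := Z) hγdiff i v d (Y i ω) s).sub h1
  convert! h2 using 1
  rw [integral_finsetSum _ fun j _ =>
    (integrable_gradAt hY hγmeas hγdiff hf₁ i j _).mul_const _, ← Finset.sum_sub_distrib]
  refine Finset.sum_congr rfl fun j _ => ?_
  rw [integral_mul_const, ← sub_mul]
  rfl

/-- Mean value inequality for the remainder of the linear approximation. -/
theorem abs_remainder_le (hY : ∀ i, Measurable (Y i)) (hγmeas : ∀ i t, Measurable (γ i t))
    (hγdiff : ∀ i y, Differentiable ℝ (fun t => γ i t y))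
    (hγint : ∀ i, Integrable (fun ω => γ i (Z i *ᵥ θ) (Y i ω)) P)
    (hf₁ : ∀ i j s y, |partialDeriv j (fun x => γ i x y) s| ≤ f₁) {u v : Fin p → ℝ} {ω : Ω}
    {C : ℝ} (hC : ∀ s ∈ Set.Icc (0 : ℝ) 1, ∀ h,
      |gradIncrement P γ Y Z θ (v + s • (u - v)) h ω| ≤ C) :
    |centeredLoss P γ Y Z u ω - centeredLoss P γ Y Z v ω - linearTerm P γ Y Z θ (u - v) ω| ≤
      C * ∑ h, |(u - v) h| := by
  -- Once the linear function is subtracted, the derivative along the segment pairs the gradient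
  -- increment with `u - v`.
  have h1 : ∀ s : ℝ, HasDerivAt (fun s : ℝ => centeredLoss P γ Y Z (v + s • (u - v)) ω
      - s * linearTerm P γ Y Z θ (u - v) ω)
      (∑ h, gradIncrement P γ Y Z θ (v + s • (u - v)) h ω * (u - v) h) s := by
    intro s
    have h2 := (hasDerivAt_centeredLoss hY hγmeas hγdiff hγint hf₁ v (u - v) ω s).sub
      ((hasDerivAt_id s).mul_const (linearTerm P γ Y Z θ (u - v) ω))
    convert! h2 using 1
    rw [linearTerm_eq_sum P γ Y Z (v + s • (u - v)), linearTerm_eq_sum P γ Y Z θ, one_mul,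
      ← Finset.sum_sub_distrib]
    exact Finset.sum_congr rfl fun h _ => by rw [gradIncrement, sub_mul]
  have h3 := norm_image_sub_le_of_norm_deriv_le_segment_01'
    (fun s _ => (h1 s).hasDerivWithinAt)
    (fun s hs => abs_sum_mul_le (d := u - v) fun h => hC s ⟨hs.1, hs.2.le⟩ h)
  rw [Real.norm_eq_abs] at h3
  convert! h3 using 2
  simp only [one_smul, zero_smul, add_zero, add_sub_cancel, one_mul, zero_mul, sub_zero]
  ring

end Calculus

/-! ### Tail bounds for the linear term and the gradient increments. -/

section Concentration

variable {Ω 𝒴 : Type*} [MeasurableSpace Ω] [MeasurableSpace 𝒴] {N k p : ℕ}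
  {P : Measure Ω} [IsProbabilityMeasure P] {Y : Fin N → Ω → 𝒴}
  {Z : Fin N → Matrix (Fin k) (Fin p) ℝ} {γ : Fin N → (Fin k → ℝ) → 𝒴 → ℝ} {f₁ f₂ : ℝ}
  {θ : Fin p → ℝ}

/-- McDiarmid's inequality when the `i`-th difference is at most `2 φ ∑_j |Z_{ijh}|`. -/
theorem measure_lt_centered_le (hY : ∀ i, Measurable (Y i)) (hYindep : iIndepFun Y P)
    {f : (Fin N → 𝒴) → ℝ} (hf : Measurable f) {B : ℝ} (hB : ∀ y, ‖f y‖ ≤ B) {φ : ℝ} (hφ : 0 ≤ φ)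
    (h : Fin p)
    (hc : ∀ i y a, |f (Function.update y i a) - f y| ≤ 2 * (φ * ∑ j, |Z i j h|)) {S L : ℝ}
    (hS : ∑ i, ∑ j, Z i j h ^ 2 ≤ S) (hL : 0 ≤ L) :
    P {ω | √(2 * k) * φ * √(L * S) < f (fun i => Y i ω)
      - ∫ y, f y ∂(Measure.pi fun i => P.map (Y i))} ≤ ENNReal.ofReal (Real.exp (-L)) := by
  have hprob : ∀ i, IsProbabilityMeasure (P.map (Y i)) := fun i =>
    Measure.isProbabilityMeasure_map (hY i).aemeasurable
  have hmap : P.map (fun ω i => Y i ω) = Measure.pi fun i => P.map (Y i) :=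
    (iIndepFun_iff_map_fun_eq_pi_map fun i => (hY i).aemeasurable).1 hYindep
  have hYm : Measurable fun ω i => Y i ω := measurable_pi_lambda _ hY
  have hc0 : ∀ i, 0 ≤ 2 * (φ * ∑ j, |Z i j h|) := fun i =>
    mul_nonneg two_pos.le (mul_nonneg hφ (Finset.sum_nonneg fun _ _ => abs_nonneg _))
  let c : Fin N → ℝ≥0 := fun i => ⟨_, hc0 i⟩
  have hsub := hasSubgaussianMGF_of_boundedDifferences (fun i => P.map (Y i)) hf hB
    (c := c) hc
  rw [← hmap] at hsub ⊢
  have hsub' := HasSubgaussianMGF.of_map hYm.aemeasurable hsub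
  have hS0 : 0 ≤ S := (Finset.sum_nonneg fun i _ => Finset.sum_nonneg fun j _ => sq_nonneg _).trans hS
  refine measure_lt_le_of_hasSubgaussianMGF hsub' (by positivity) ?_
  rw [mul_pow, mul_pow, Real.sq_sqrt (by positivity), Real.sq_sqrt (by positivity)]
  -- Cauchy–Schwarz over the `k` rows; it accounts for the `k` in `√(2k)`, the `2` being that of the
  -- sub-Gaussian tail.
  have h1 : ∑ i, (∑ j, |Z i j h|) ^ 2 ≤ k * S := by
    refine le_trans ?_ (mul_le_mul_of_nonneg_left hS (Nat.cast_nonneg k))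
    rw [Finset.mul_sum]
    refine Finset.sum_le_sum fun i _ => ?_
    simpa using sq_sum_le_card_mul_sum_sq (s := (Finset.univ : Finset (Fin k)))
      (f := fun j => |Z i j h|)
  have h2 : ((∑ i, (c i / 2) ^ 2 : ℝ≥0) : ℝ) = φ ^ 2 * ∑ i, (∑ j, |Z i j h|) ^ 2 := by
    push_cast
    rw [Finset.mul_sum]
    refine Finset.sum_congr rfl fun i _ => ?_
    change (2 * (φ * ∑ j, |Z i j h|) / 2) ^ 2 = _
    ring
  rw [h2]
  have h3 := mul_le_mul_of_nonneg_left h1 (mul_nonneg (sq_nonneg φ) hL)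
  nlinarith

theorem sum_update_sub {E : Type*} [AddCommGroup E] {α : Type*} (X : Fin N → α → E) (i : Fin N)
    (y : Fin N → α) (a : α) :
    ∑ l, X l (Function.update y i a l) - ∑ l, X l (y l) = X i a - X i (y i) := by
  rw [← Finset.sum_sub_distrib, Finset.sum_eq_single i]
  · simp
  · intro l _ hl
    simp [hl]
  · simp

theorem abs_linearTerm_tail (hY : ∀ i, Measurable (Y i)) (hYindep : iIndepFun Y P)
    (hγmeas : ∀ i t, Measurable (γ i t)) (hγdiff : ∀ i y, Differentiable ℝ (fun t => γ i t y))
    (hf₁0 : 0 ≤ f₁) (hf₁ : ∀ i j s y, |partialDeriv j (fun x => γ i x y) s| ≤ f₁) (h : Fin p)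
    {S L : ℝ} (hS : ∑ i, ∑ j, Z i j h ^ 2 ≤ S) (hL : 0 ≤ L) :
    P {ω | √(2 * k) * f₁ * √(L * S) < |linearTerm P γ Y Z θ (Pi.single h 1) ω|} ≤
      ENNReal.ofReal (2 * Real.exp (-L)) := by
  have hprob : ∀ i, IsProbabilityMeasure (P.map (Y i)) := fun i =>
    Measure.isProbabilityMeasure_map (hY i).aemeasurable
  let X : Fin N → 𝒴 → ℝ := fun i y => ∑ j, gradAt γ Z i j θ y * Z i j h
  have hX : ∀ i, Measurable (X i) := fun i =>
    Finset.measurable_sum _ fun j _ => (measurable_gradAt hγmeas hγdiff i j θ).mul_const _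
  have hXB : ∀ i y, ‖X i y‖ ≤ f₁ * ∑ j, |Z i j h| := fun i y => abs_sum_mul_le fun j => hf₁ i j _ y
  let f : (Fin N → 𝒴) → ℝ := fun y => ∑ i, X i (y i)
  have hf : Measurable f := Finset.measurable_sum _ fun i _ => (hX i).comp (measurable_pi_apply i)
  have hfB : ∀ y, ‖f y‖ ≤ ∑ i, f₁ * ∑ j, |Z i j h| := fun y =>
    (norm_sum_le _ _).trans (Finset.sum_le_sum fun i _ => hXB i _)
  have hc : ∀ i y a, |f (Function.update y i a) - f y| ≤ 2 * (f₁ * ∑ j, |Z i j h|) := by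
    intro i y a
    rw [sum_update_sub, two_mul]
    exact (norm_sub_le _ _).trans (add_le_add (hXB i _) (hXB i _))
  have hEf : ∀ ω, f (fun i => Y i ω) - ∫ y, f y ∂(Measure.pi fun i => P.map (Y i))
      = linearTerm P γ Y Z θ (Pi.single h 1) ω := by
    intro ω
    have hi : ∀ i ∈ Finset.univ, Integrable (fun y : Fin N → 𝒴 => X i (y i))
        (Measure.pi fun i => P.map (Y i)) := fun i _ =>
      integrable_of_abs_le ((hX i).comp (measurable_pi_apply i)) fun y => hXB i (y i)
    rw [linearTerm_single, integral_finsetSum _ hi, ← Finset.sum_sub_distrib]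
    refine Finset.sum_congr rfl fun i _ => ?_
    rw [integral_comp_eval (μ := fun i => P.map (Y i)) (hX i).aestronglyMeasurable,
      integral_map (hY i).aemeasurable (hX i).aestronglyMeasurable,
      integral_finsetSum _ fun j _ => (integrable_gradAt hY hγmeas hγdiff hf₁ i j θ).mul_const _,
      ← Finset.sum_sub_distrib]
    exact Finset.sum_congr rfl fun j _ => by rw [integral_mul_const, sub_mul]
  have t1 := measure_lt_centered_le hY hYindep hf hfB hf₁0 h hc hS hL
  have t2 := measure_lt_centered_le hY hYindep (f := fun y => - f y) hf.neg
    (fun y => by rw [norm_neg]; exact hfB y) hf₁0 h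
    (fun i y a => by rw [neg_sub_neg, abs_sub_comm]; exact hc i y a) hS hL
  have hEf' : ∀ ω, -f (fun i => Y i ω) - ∫ y, -f y ∂(Measure.pi fun i => P.map (Y i))
      = -linearTerm P γ Y Z θ (Pi.single h 1) ω := by
    intro ω
    rw [integral_neg, ← hEf]
    ring
  simp only [hEf] at t1
  simp only [hEf'] at t2
  set b := √(2 * k) * f₁ * √(L * S)
  have hcover : {ω | b < |linearTerm P γ Y Z θ (Pi.single h 1) ω|} ⊆
      {ω | b < linearTerm P γ Y Z θ (Pi.single h 1) ω}
        ∪ {ω | b < -linearTerm P γ Y Z θ (Pi.single h 1) ω} := by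
    intro ω hω
    exact lt_abs.1 (show b < |linearTerm P γ Y Z θ (Pi.single h 1) ω| from hω)
  refine (measure_mono hcover).trans
    ((measure_union_le _ _).trans ((add_le_add t1 t2).trans (le_of_eq ?_)))
  rw [← ENNReal.ofReal_add (Real.exp_pos _).le (Real.exp_pos _).le, two_mul]

/-- For finite `W` the supremum over `w` is the sup norm in `W → ℝ` of a sum of independent centered
vectors: McDiarmid's inequality bounds its deviation, symmetrization and contraction its mean. -/
theorem gradIncrement_tail_finset (hk : 0 < k) (hp : 0 < p) (hY : ∀ i, Measurable (Y i))
    (hYindep : iIndepFun Y P)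
    (hγmeas : ∀ i t, Measurable (γ i t)) (hγdiff : ∀ i y, Differentiable ℝ (fun t => γ i t y))
    (hf₁ : ∀ i j s y, |partialDeriv j (fun x => γ i x y) s| ≤ f₁)
    (hf₂ : ∀ i j s t y, |partialDeriv j (fun x => γ i x y) s - partialDeriv j (fun x => γ i x y) t|
      ≤ f₂ * ‖s - t‖) (hf₂0 : 0 ≤ f₂) {M : ℝ} (hM0 : 0 ≤ M) (hM : ∀ i j h, |Z i j h| ≤ M) {R : ℝ}
    {W : Finset (Fin p → ℝ)} (hW : ∀ w ∈ W, ∑ l, |(w - θ) l| ≤ R) (hR : 0 ≤ R) {φ : ℝ}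
    (hφ0 : 0 ≤ φ) (hφ : ∀ w ∈ W, ∀ i j y, |gradAt γ Z i j w y - gradAt γ Z i j θ y| ≤ φ)
    {V : Fin k → ℝ} (hV : ∀ j h, ∑ i, Z i j h ^ 2 ≤ V j) (h : Fin p) {S L : ℝ}
    (hS : ∑ i, ∑ j, Z i j h ^ 2 ≤ S) (hL : 0 ≤ L) :
    P {ω | ∃ w ∈ W, 2 * (2 * ∑ j, k * f₂ * M * R * (√2 * √(Real.log (2 * p)) * √(V j)))
      + √(2 * k) * φ * √(L * S) < |gradIncrement P γ Y Z θ w h ω|} ≤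
      ENNReal.ofReal (Real.exp (-L)) := by
  have hprob : ∀ i, IsProbabilityMeasure (P.map (Y i)) := fun i =>
    Measure.isProbabilityMeasure_map (hY i).aemeasurable
  -- This `2` stems from the absolute values in the contraction; symmetrization doubles once more.
  set K := 2 * ∑ j, k * f₂ * M * R * (√2 * √(Real.log (2 * p)) * √(V j))
  let X : Fin N → 𝒴 → W → ℝ := fun i y w =>
    ∑ j, (gradAt γ Z i j w.1 y - gradAt γ Z i j θ y) * Z i j h
  have hXw : ∀ i (w : W), Measurable fun y => X i y w := fun i w =>
    Finset.measurable_sum _ fun j _ => ((measurable_gradAt hγmeas hγdiff i j w.1).sub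
      (measurable_gradAt hγmeas hγdiff i j θ)).mul_const _
  have hX : ∀ i, Measurable (X i) := fun i => measurable_pi_lambda _ (hXw i)
  have hb0 : ∀ i, 0 ≤ φ * ∑ j, |Z i j h| := fun i =>
    mul_nonneg hφ0 (Finset.sum_nonneg fun _ _ => abs_nonneg _)
  have hXB : ∀ i y, ‖X i y‖ ≤ φ * ∑ j, |Z i j h| := fun i y =>
    (pi_norm_le_iff_of_nonneg (hb0 i)).2 fun w => abs_sum_mul_le fun j => hφ w.1 w.2 i j y
  have hXB' : ∀ i y, ‖X i y‖ ≤ ∑ i, φ * ∑ j, |Z i j h| := fun i y =>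
    (hXB i y).trans (Finset.single_le_sum (f := fun i => φ * ∑ j, |Z i j h|)
      (fun i _ => hb0 i) (Finset.mem_univ i))
  let X' : Fin N → 𝒴 → W → ℝ := fun i y => X i y - ∫ a, X i a ∂P.map (Y i)
  let f : (Fin N → 𝒴) → ℝ := fun y => ‖∑ i, X' i (y i)‖
  have hf : Measurable f := (Finset.measurable_sum _ fun i _ =>
    ((hX i).comp (measurable_pi_apply i)).sub_const _).norm
  have hfB : ∀ y, ‖f y‖ ≤ ∑ i, (φ * ∑ j, |Z i j h| + φ * ∑ j, |Z i j h|) := by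
    intro y
    rw [norm_norm]
    refine (norm_sum_le _ _).trans (Finset.sum_le_sum fun i _ => ?_)
    refine (norm_sub_le _ _).trans (add_le_add (hXB i _) ?_)
    simpa using norm_integral_le_of_norm_le_const (μ := P.map (Y i))
      (Filter.Eventually.of_forall (hXB i))
  have hc : ∀ i y a, |f (Function.update y i a) - f y| ≤ 2 * (φ * ∑ j, |Z i j h|) := by
    intro i y a
    refine (abs_norm_sub_norm_le _ _).trans ?_
    rw [sum_update_sub, sub_sub_sub_cancel_right, two_mul]
    exact (norm_sub_le _ _).trans (add_le_add (hXB i _) (hXB i _))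
  have hEf : ∫ y, f y ∂(Measure.pi fun i => P.map (Y i)) ≤ 2 * K :=
    integral_norm_centered_sum_le _ hX hXB' fun y =>
      expect_norm_gradIncrement_le hk hp hf₂ hf₂0 hM0 hM hW hR hV h y
  have hcoord : ∀ (w : W) ω, gradIncrement P γ Y Z θ w.1 h ω = (∑ i, X' i (Y i ω)) w := by
    intro w ω
    rw [gradIncrement, linearTerm_single, linearTerm_single, ← Finset.sum_sub_distrib,
      Finset.sum_apply]
    refine Finset.sum_congr rfl fun i _ => ?_
    have e : (∫ a, X i a ∂P.map (Y i)) w = ∫ a, X i a w ∂P.map (Y i) :=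
      eval_integral (fun w => integrable_of_abs_le (hXw i w) fun y =>
        (norm_le_pi_norm (X i y) w).trans (hXB i y)) w
    simp only [X', Pi.sub_apply]
    rw [e, integral_map (hY i).aemeasurable (hXw i w).aestronglyMeasurable]
    have g := fun j w => integrable_gradAt (P := P) (Z := Z) hY hγmeas hγdiff hf₁ i j w
    have g' : ∀ j ∈ Finset.univ, Integrable (fun ω =>
        (gradAt γ Z i j w.1 (Y i ω) - gradAt γ Z i j θ (Y i ω)) * Z i j h) P := fun j _ =>
      ((g j w.1).sub (g j θ)).mul_const _
    simp only [X]
    rw [integral_finsetSum _ g', ← Finset.sum_sub_distrib, ← Finset.sum_sub_distrib]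
    refine Finset.sum_congr rfl fun j _ => ?_
    rw [integral_mul_const, integral_sub (g j w.1) (g j θ)]
    ring
  refine (measure_mono ?_).trans (measure_lt_centered_le hY hYindep hf hfB hφ0 h hc hS hL)
  rintro ω ⟨w, hw, hlt⟩
  have h1 : |gradIncrement P γ Y Z θ w h ω| ≤ f fun i => Y i ω := by
    rw [hcoord ⟨w, hw⟩ ω]
    exact norm_le_pi_norm (∑ i, X' i (Y i ω)) ⟨w, hw⟩
  simp only [Set.mem_ofPred_eq]
  linarith

/-- By continuity in `w`, a strict excess somewhere in the ball occurs at a point of a dense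
sequence. The events for its initial pieces increase, so their common bound passes to the union. -/
theorem gradIncrement_tail_ball (hk : 0 < k) (hp : 0 < p) (hY : ∀ i, Measurable (Y i))
    (hYindep : iIndepFun Y P)
    (hγmeas : ∀ i t, Measurable (γ i t)) (hγdiff : ∀ i y, Differentiable ℝ (fun t => γ i t y))
    (hf₁ : ∀ i j s y, |partialDeriv j (fun x => γ i x y) s| ≤ f₁)
    (hf₂ : ∀ i j s t y, |partialDeriv j (fun x => γ i x y) s - partialDeriv j (fun x => γ i x y) t|
      ≤ f₂ * ‖s - t‖) (hf₂0 : 0 ≤ f₂) {M : ℝ} (hM0 : 0 ≤ M) (hM : ∀ i j h, |Z i j h| ≤ M) {R : ℝ}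
    (hR : 0 ≤ R) {φ : ℝ} (hφ0 : 0 ≤ φ)
    (hφ : ∀ w : Fin p → ℝ, ∑ l, |(w - θ) l| ≤ R → ∀ i j y,
      |gradAt γ Z i j w y - gradAt γ Z i j θ y| ≤ φ)
    {V : Fin k → ℝ} (hV : ∀ j h, ∑ i, Z i j h ^ 2 ≤ V j) (h : Fin p) {S L : ℝ}
    (hS : ∑ i, ∑ j, Z i j h ^ 2 ≤ S) (hL : 0 ≤ L) :
    P {ω | ∃ w : Fin p → ℝ, ∑ l, |(w - θ) l| ≤ R ∧
      2 * (2 * ∑ j, k * f₂ * M * R * (√2 * √(Real.log (2 * p)) * √(V j)))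
        + √(2 * k) * φ * √(L * S) < |gradIncrement P γ Y Z θ w h ω|} ≤
      ENNReal.ofReal (Real.exp (-L)) := by
  set s := 2 * (2 * ∑ j, k * f₂ * M * R * (√2 * √(Real.log (2 * p)) * √(V j)))
    + √(2 * k) * φ * √(L * S)
  let B := {w : Fin p → ℝ // ∑ l, |(w - θ) l| ≤ R}
  have : Nonempty B := ⟨⟨θ, by simpa using hR⟩⟩
  let e : ℕ → B := TopologicalSpace.denseSeq B
  classical
  let A : ℕ → Set Ω := fun n =>
    {ω | ∃ w ∈ (Finset.range n).image fun i => (e i).1, s < |gradIncrement P γ Y Z θ w h ω|}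
  have hA : ∀ n, P (A n) ≤ ENNReal.ofReal (Real.exp (-L)) := fun n => by
    have hin : ∀ w ∈ (Finset.range n).image fun i => (e i).1, ∑ l, |(w - θ) l| ≤ R := by
      intro w hw
      obtain ⟨i, -, rfl⟩ := Finset.mem_image.1 hw
      exact (e i).2
    exact gradIncrement_tail_finset hk hp hY hYindep hγmeas hγdiff hf₁ hf₂ hf₂0 hM0 hM hin hR hφ0
      (fun w hw => hφ w (hin w hw)) hV h hS hL
  have hmono : Monotone A := by
    rintro m n hmn ω ⟨w, hw, hlt⟩
    exact ⟨w, Finset.image_subset_image (Finset.range_subset_range.2 hmn) hw, hlt⟩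
  refine (measure_mono ?_).trans ((hmono.measure_iUnion).le.trans (iSup_le hA))
  rintro ω ⟨w, hw, hlt⟩
  have hcont : Continuous fun w : B => |gradIncrement P γ Y Z θ w.1 h ω| :=
    ((continuous_gradIncrement hY hγmeas hγdiff hf₁ hf₂ h ω).comp continuous_subtype_val).abs
  obtain ⟨_, hx, ⟨n, rfl⟩⟩ := (TopologicalSpace.denseRange_denseSeq B).exists_mem_open
    (isOpen_lt continuous_const hcont) ⟨⟨w, hw⟩, hlt⟩ |> fun ⟨n, hn⟩ =>
      (⟨e n, hn, ⟨n, rfl⟩⟩ : ∃ x : B, s < |gradIncrement P γ Y Z θ x.1 h ω| ∧ ∃ n, e n = x)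
  exact Set.mem_iUnion.2 ⟨n + 1, (e n).1,
    Finset.mem_image.2 ⟨n, Finset.mem_range.2 n.lt_succ_self, rfl⟩, hx⟩

end Concentration

/-! ### Passage between extended and real constants. -/

section Bridge

variable {Ω 𝒴 : Type*} {N k p : ℕ} {Z : Fin N → Matrix (Fin k) (Fin p) ℝ}
  {γ : Fin N → (Fin k → ℝ) → 𝒴 → ℝ} {D : Set (Fin p → ℝ)} {θ : Fin p → ℝ}

theorem abs_le_toReal_of_enorm_le {x : ℝ} {a : ℝ≥0∞} (ha : a < ∞) (h : ‖x‖ₑ ≤ a) :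
    |x| ≤ a.toReal := by
  simpa using ENNReal.toReal_mono ha.ne h

theorem abs_partialDeriv_le_F₁ (hF₁ : F₁ γ < ∞) (i : Fin N) (j : Fin k) (s : Fin k → ℝ) (y : 𝒴) :
    |partialDeriv j (fun x => γ i x y) s| ≤ (F₁ γ).toReal :=
  abs_le_toReal_of_enorm_le hF₁ (le_iSup_of_le i (le_iSup_of_le y (le_iSup_of_le j
    (le_iSup (fun s => ‖partialDeriv j (fun x => γ i x y) s‖ₑ) s))))

theorem abs_partialDeriv_sub_le_F₂ (hF₂ : F₂ γ < ∞) (i : Fin N) (j : Fin k) (s t : Fin k → ℝ)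
    (y : 𝒴) :
    |partialDeriv j (fun x => γ i x y) s - partialDeriv j (fun x => γ i x y) t| ≤
      (F₂ γ).toReal * ‖s - t‖ := by
  rcases eq_or_ne s t with rfl | hst
  · simp
  · have h1 : ‖partialDeriv j (fun x => γ i x y) s - partialDeriv j (fun x => γ i x y) t‖ₑ
        / ‖t - s‖ₑ ≤ F₂ γ :=
      le_iSup_of_le i (le_iSup_of_le y (le_iSup_of_le j (le_iSup_of_le s (le_iSup_of_le t
        (le_iSup (fun _ : s ≠ t => ‖partialDeriv j (fun x => γ i x y) s
          - partialDeriv j (fun x => γ i x y) t‖ₑ / ‖t - s‖ₑ) hst)))))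
    have h0 : ‖t - s‖ₑ ≠ 0 := enorm_ne_zero.2 (sub_ne_zero.2 hst.symm)
    rw [ENNReal.div_le_iff h0 enorm_ne_top] at h1
    have h2 := ENNReal.toReal_mono (ENNReal.mul_lt_top hF₂ enorm_lt_top).ne h1
    rw [ENNReal.toReal_mul, toReal_enorm, toReal_enorm, Real.norm_eq_abs, norm_sub_rev t s] at h2
    exact h2

theorem enorm_le_MZ (i : Fin N) (j : Fin k) (h : Fin p) : ‖Z i j h‖ₑ ≤ MZ Z :=
  le_iSup_of_le i (le_iSup_of_le j (le_iSup (fun h => ‖Z i j h‖ₑ) h))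

theorem MZ_lt_top : MZ Z < ∞ := by
  refine lt_of_le_of_lt (b := ∑ i, ∑ j, ∑ h, ‖Z i j h‖ₑ) ?_ ?_
  · refine iSup_le fun i => iSup_le fun j => iSup_le fun h => ?_
    exact (Finset.single_le_sum (f := fun h => ‖Z i j h‖ₑ) (fun _ _ => zero_le)
      (Finset.mem_univ h)).trans ((Finset.single_le_sum (f := fun j => ∑ h, ‖Z i j h‖ₑ)
      (fun _ _ => zero_le) (Finset.mem_univ j)).trans (Finset.single_le_sum
      (f := fun i => ∑ j, ∑ h, ‖Z i j h‖ₑ) (fun _ _ => zero_le) (Finset.mem_univ i)))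
  · simp [ENNReal.sum_lt_top]

theorem abs_le_MZ (i : Fin N) (j : Fin k) (h : Fin p) : |Z i j h| ≤ (MZ Z).toReal :=
  abs_le_toReal_of_enorm_le MZ_lt_top (enorm_le_MZ i j h)

theorem l1Norm_eq_ofReal (d : Fin p → ℝ) : l1Norm d = ENNReal.ofReal (∑ h, |d h|) := by
  rw [l1Norm, ENNReal.ofReal_sum_of_nonneg fun _ _ => abs_nonneg _]
  exact Finset.sum_congr rfl fun h _ => by rw [← ofReal_norm, Real.norm_eq_abs]

theorem sum_abs_sub_le_RD (hD : RD D < ∞) {u v : Fin p → ℝ} (hu : u ∈ D) (hv : v ∈ D) :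
    ∑ h, |(u - v) h| ≤ (RD D).toReal := by
  have h1 : l1Norm (u - v) ≤ RD D :=
    le_iSup₂_of_le u hu (le_iSup₂ (f := fun v (_ : v ∈ D) => l1Norm (u - v)) v hv)
  rw [l1Norm_eq_ofReal] at h1
  exact (ENNReal.ofReal_le_iff_le_toReal hD.ne).1 h1

theorem sqrtE_ofReal {x : ℝ} (hx : 0 ≤ x) : sqrtE (ENNReal.ofReal x) = ENNReal.ofReal √x := by
  rw [sqrtE, ENNReal.ofReal_rpow_of_nonneg hx (by norm_num), Real.sqrt_eq_rpow]

theorem sqrtE_mono {x y : ℝ≥0∞} (h : x ≤ y) : sqrtE x ≤ sqrtE y :=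
  ENNReal.rpow_le_rpow h (by norm_num)

theorem sqrtE_two_mul : sqrtE (2 * k) = ENNReal.ofReal √(2 * k) := by
  rw [← sqrtE_ofReal (by positivity), ENNReal.ofReal_mul (by norm_num)]
  simp

theorem ofReal_iSup_le {ι : Type*} [Finite ι] [Nonempty ι] {f : ι → ℝ} {g : ι → ℝ≥0∞}
    (h : ∀ i, ENNReal.ofReal (f i) ≤ g i) : ENNReal.ofReal (⨆ i, f i) ≤ ⨆ i, g i := by
  obtain ⟨i, hi⟩ := exists_eq_ciSup_of_finite (f := f)
  rw [← hi]
  exact (h i).trans (le_iSup g i)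

theorem ofReal_sq_eq (x : ℝ) : ENNReal.ofReal (x ^ 2) = ‖x‖ₑ ^ 2 := by
  rw [← ofReal_norm, ← ENNReal.ofReal_pow (norm_nonneg _), Real.norm_eq_abs, sq_abs]

/-- `max_h ∑_i Z_{ijh}²` as a real number. -/
noncomputable def colMax (Z : Fin N → Matrix (Fin k) (Fin p) ℝ) (j : Fin k) : ℝ :=
  ⨆ h : Fin p, ∑ i, Z i j h ^ 2

/-- `max_h ∑_{i,j} Z_{ijh}²` as a real number. -/
noncomputable def totalMax (Z : Fin N → Matrix (Fin k) (Fin p) ℝ) : ℝ :=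
  ⨆ h : Fin p, ∑ i, ∑ j, Z i j h ^ 2

theorem le_colMax (j : Fin k) (h : Fin p) : ∑ i, Z i j h ^ 2 ≤ colMax Z j :=
  le_ciSup (f := fun h => ∑ i, Z i j h ^ 2) (Set.finite_range _).bddAbove h

theorem le_totalMax (h : Fin p) : ∑ i, ∑ j, Z i j h ^ 2 ≤ totalMax Z :=
  le_ciSup (f := fun h => ∑ i, ∑ j, Z i j h ^ 2) (Set.finite_range _).bddAbove h

theorem colMax_nonneg (j : Fin k) : 0 ≤ colMax Z j :=
  Real.iSup_nonneg fun _ => Finset.sum_nonneg fun _ _ => sq_nonneg _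

theorem totalMax_nonneg : 0 ≤ totalMax Z :=
  Real.iSup_nonneg fun _ => Finset.sum_nonneg fun _ _ => Finset.sum_nonneg fun _ _ => sq_nonneg _

theorem ofReal_sum_colMax_le (hp : 0 < p) : ENNReal.ofReal (∑ j, colMax Z j) ≤ sumMaxSq Z := by
  have : Nonempty (Fin p) := ⟨⟨0, hp⟩⟩
  rw [ENNReal.ofReal_sum_of_nonneg fun j _ => colMax_nonneg j]
  refine Finset.sum_le_sum fun j _ => ofReal_iSup_le fun h => ?_
  rw [ENNReal.ofReal_sum_of_nonneg fun _ _ => sq_nonneg _]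
  simp only [ofReal_sq_eq, le_refl]

theorem ofReal_totalMax_le (hp : 0 < p) : ENNReal.ofReal (totalMax Z) ≤ maxSumSq Z := by
  have : Nonempty (Fin p) := ⟨⟨0, hp⟩⟩
  refine ofReal_iSup_le fun h => ?_
  rw [ENNReal.ofReal_sum_of_nonneg fun _ _ => Finset.sum_nonneg fun _ _ => sq_nonneg _]
  refine Finset.sum_le_sum fun i _ => ?_
  rw [ENNReal.ofReal_sum_of_nonneg fun _ _ => sq_nonneg _]
  simp only [ofReal_sq_eq, le_refl]

theorem ofReal_sqrt_mul_le {x a : ℝ} {b : ℝ≥0∞} (hx : 0 ≤ x) (ha : 0 ≤ a)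
    (h : ENNReal.ofReal a ≤ b) : ENNReal.ofReal √(x * a) ≤ sqrtE (ENNReal.ofReal x * b) := by
  rw [← sqrtE_ofReal (mul_nonneg hx ha), ENNReal.ofReal_mul hx]
  exact sqrtE_mono (mul_le_mul_right h _)

/-- Cauchy–Schwarz over `j` pulls the sum inside the root for a factor `√k`, and `β_{2k}` is lowered
to `1`. A factor `2` is left over. -/
theorem ofReal_expectation_part_le (hk : 0 < k) (hp : 0 < p) (hF₂ : F₂ γ < ∞) (hD : RD D < ∞) :
    ENNReal.ofReal (2 * (2 * ∑ j, k * (F₂ γ).toReal * (MZ Z).toReal * (RD D).toReal *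
      (√2 * √(Real.log (2 * p)) * √(colMax Z j)))) ≤
    constA γ Z D * sqrtE (ENNReal.ofReal (Real.log (2 * p)) * sumMaxSq Z) := by
  have hV0 : 0 ≤ ∑ j, colMax Z j := Finset.sum_nonneg fun j _ => colMax_nonneg j
  have hℓ := (two_log_pos hp).le
  set f₂ := (F₂ γ).toReal with hf₂
  set M := (MZ Z).toReal with hM
  set R := (RD D).toReal with hR
  have f₂0 : 0 ≤ f₂ := ENNReal.toReal_nonneg
  have M0 : 0 ≤ M := ENNReal.toReal_nonneg
  have R0 : 0 ≤ R := ENNReal.toReal_nonneg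
  have hA : ENNReal.ofReal (4 * √(2 * k) * R * (2 * k * 1 * M * f₂)) ≤ constA γ Z D := by
    rw [constA, psi, ← ENNReal.ofReal_toReal hF₂.ne, ← ENNReal.ofReal_toReal hD.ne,
      ← ENNReal.ofReal_toReal (MZ_lt_top (Z := Z)).ne, sqrtE_two_mul]
    rw [ENNReal.ofReal_mul (by positivity), ENNReal.ofReal_mul (by positivity),
      ENNReal.ofReal_mul (by positivity), ENNReal.ofReal_mul (by positivity),
      ENNReal.ofReal_mul (by positivity), ENNReal.ofReal_mul (by positivity),
      ENNReal.ofReal_mul (by positivity)]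
    simp only [ENNReal.ofReal_ofNat, ENNReal.ofReal_natCast, ENNReal.ofReal_one]
    have := one_le_betaConst (m := 2 * k) (by omega)
    gcongr
  have hsq : ∑ j, √(colMax Z j) ≤ √k * √(∑ j, colMax Z j) := by
    rw [← Real.sqrt_mul (Nat.cast_nonneg k)]
    refine Real.le_sqrt_of_sq_le ?_
    have h1 := sq_sum_le_card_mul_sum_sq (s := (Finset.univ : Finset (Fin k)))
      (f := fun j => √(colMax Z j))
    simpa [Real.sq_sqrt (colMax_nonneg (Z := Z) _)] using h1
  refine le_trans ?_ (mul_le_mul' hA (ofReal_sqrt_mul_le hℓ hV0 (ofReal_sum_colMax_le hp)))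
  rw [← ENNReal.ofReal_mul (by positivity)]
  refine ENNReal.ofReal_le_ofReal ?_
  rw [← Finset.mul_sum, ← Finset.mul_sum, Real.sqrt_mul two_pos.le, Real.sqrt_mul hℓ]
  set c := k * f₂ * M * R * (√2 * √(Real.log (2 * p))) with hc
  have hc0 : 0 ≤ c := by positivity
  have h1 := mul_le_mul_of_nonneg_left hsq hc0
  have h2 : 0 ≤ c * (√k * √(∑ j, colMax Z j)) := by positivity
  calc 2 * (2 * (k * f₂ * M * R * (√2 * √(Real.log (2 * p)) * ∑ j, √(colMax Z j))))
      = 4 * (c * ∑ j, √(colMax Z j)) := by rw [hc]; ring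
    _ ≤ 8 * (c * (√k * √(∑ j, colMax Z j))) := by linarith
    _ = _ := by rw [hc]; ring

theorem ofReal_deviation_part_le (hp : 0 < p) (hF₁ : F₁ γ < ∞) (hF₂ : F₂ γ < ∞) (hD : RD D < ∞)
    {L : ℝ} (hL : 0 ≤ L) :
    ENNReal.ofReal (√(2 * k) * (2 * min (F₁ γ).toReal ((F₂ γ).toReal * (MZ Z).toReal
      * (RD D).toReal)) * √(L * totalMax Z)) ≤
    constB γ Z D * sqrtE (ENNReal.ofReal L * maxSumSq Z) := by
  have hm : 0 ≤ min (F₁ γ).toReal ((F₂ γ).toReal * (MZ Z).toReal * (RD D).toReal) := by positivity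
  rw [ENNReal.ofReal_mul (by positivity), ENNReal.ofReal_mul (by positivity),
    ENNReal.ofReal_mul (by positivity), constB, phi, sqrtE_two_mul,
    ENNReal.ofReal_mono.map_min, ENNReal.ofReal_mul (by positivity),
    ENNReal.ofReal_mul (by positivity), ENNReal.ofReal_toReal hF₁.ne,
    ENNReal.ofReal_toReal hF₂.ne, ENNReal.ofReal_toReal hD.ne,
    ENNReal.ofReal_toReal (MZ_lt_top (Z := Z)).ne, ENNReal.ofReal_ofNat]
  exact mul_le_mul_right (ofReal_sqrt_mul_le hL totalMax_nonneg (ofReal_totalMax_le hp)) _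

theorem ofReal_linear_part_le (hp : 0 < p) (hF₁ : F₁ γ < ∞) {q : ℝ}
    (hL : 0 ≤ Real.log (2 * p / q)) :
    ENNReal.ofReal (√(2 * k) * (F₁ γ).toReal * √(Real.log (2 * p / q) * totalMax Z)) ≤
      linearBound γ Z q := by
  rw [ENNReal.ofReal_mul (by positivity), ENNReal.ofReal_mul (by positivity), linearBound,
    sqrtE_two_mul, ENNReal.ofReal_toReal hF₁.ne]
  exact mul_le_mul_right (ofReal_sqrt_mul_le hL totalMax_nonneg (ofReal_totalMax_le hp)) _

theorem MZ_eq_zero_of_sumMaxSq_eq_zero (h : sumMaxSq Z = 0) : MZ Z = 0 := by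
  simp only [sumMaxSq, Finset.sum_eq_zero_iff, Finset.mem_univ, true_imp_iff,
    ENNReal.iSup_eq_zero, pow_eq_zero_iff two_ne_zero] at h
  simp only [MZ, ENNReal.iSup_eq_zero]
  exact fun i j l => h j l i

/-- Disposes of unbounded `D`: the assertion is then vacuous unless `M_Z F₂ = 0`, where the
convention `0 * ∞ = 0` makes the bound finite. -/
theorem tailBound_eq_top (hk : 0 < k) (hp : 0 < p) (hD : RD D = ∞) (hZ : MZ Z ≠ 0)
    (hF : F₂ γ ≠ 0) (q : ℝ) : tailBound γ Z D q = ∞ := by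
  have hk' : (k : ℝ≥0∞) ≠ 0 := by exact_mod_cast hk.ne'
  have hsqrt : ∀ {x : ℝ≥0∞}, x ≠ 0 → sqrtE x ≠ 0 := fun {x} hx h => by
    rw [sqrtE, ENNReal.rpow_eq_zero_iff_of_pos (by norm_num)] at h
    exact hx h
  have hβ : betaConst (2 * k) ≠ 0 :=
    (zero_lt_one.trans_le (one_le_betaConst (m := 2 * k) (by omega))).ne'
  have hψ : psi γ Z ≠ 0 := by
    simp [psi, hk', hβ, hZ, hF]
  have hA : constA γ Z D = ∞ := by
    rw [constA, hD, ENNReal.mul_top, ENNReal.top_mul hψ]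
    exact mul_ne_zero (by norm_num) (hsqrt (mul_ne_zero two_ne_zero hk'))
  have hs : sqrtE (ENNReal.ofReal (Real.log (2 * p)) * sumMaxSq Z) ≠ 0 :=
    hsqrt (mul_ne_zero (by simpa using two_log_pos hp)
      fun h => hZ (MZ_eq_zero_of_sumMaxSq_eq_zero h))
  rw [tailBound, hA, ENNReal.top_mul hs]
  simp

theorem norm_mulVec_le {M R : ℝ} (hM0 : 0 ≤ M) (hM : ∀ i j h, |Z i j h| ≤ M) {d : Fin p → ℝ}
    (hd : ∑ h, |d h| ≤ R) (i : Fin N) : ‖Z i *ᵥ d‖ ≤ M * R := by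
  have hR : 0 ≤ R := (Finset.sum_nonneg fun _ _ => abs_nonneg _).trans hd
  exact (pi_norm_le_iff_of_nonneg (mul_nonneg hM0 hR)).2 fun j =>
    (abs_sum_mul_le (hM i j)).trans (mul_le_mul_of_nonneg_left hd hM0)

theorem sum_abs_segment_sub_le {R : ℝ} {u v : Fin p → ℝ} (hu : ∑ h, |(u - θ) h| ≤ R)
    (hv : ∑ h, |(v - θ) h| ≤ R) {s : ℝ} (hs : s ∈ Set.Icc (0 : ℝ) 1) :
    ∑ h, |(v + s • (u - v) - θ) h| ≤ R := by
  have h1 : ∀ h, |(v + s • (u - v) - θ) h| ≤ s * |(u - θ) h| + (1 - s) * |(v - θ) h| := by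
    intro h
    have e : (v + s • (u - v) - θ) h = s * (u - θ) h + (1 - s) * (v - θ) h := by
      simp; ring
    rw [e]
    refine (abs_add_le _ _).trans (le_of_eq ?_)
    rw [abs_mul, abs_mul, abs_of_nonneg hs.1, abs_of_nonneg (sub_nonneg.2 hs.2)]
  refine (Finset.sum_le_sum fun h _ => h1 h).trans ?_
  rw [Finset.sum_add_distrib, ← Finset.mul_sum, ← Finset.mul_sum]
  have h2 := mul_le_mul_of_nonneg_left hu hs.1
  have h3 := mul_le_mul_of_nonneg_left hv (sub_nonneg.2 hs.2)
  linarith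

theorem exp_neg_log_div {a q : ℝ} (ha : 0 < a) (hq : 0 < q) :
    Real.exp (-Real.log (a / q)) = q / a := by
  rw [← Real.log_inv, Real.exp_log (by positivity), inv_div]

theorem enorm_le_mul_l1Norm {x s : ℝ} {b : ℝ≥0∞} {d : Fin p → ℝ} (h : |x| ≤ s * ∑ h, |d h|)
    (hs : ENNReal.ofReal s ≤ b) : ‖x‖ₑ ≤ b * l1Norm d := by
  rw [← ofReal_norm, Real.norm_eq_abs, l1Norm_eq_ofReal]
  refine (ENNReal.ofReal_le_ofReal h).trans ?_
  rw [ENNReal.ofReal_mul' (Finset.sum_nonneg fun _ _ => abs_nonneg _)]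
  exact mul_le_mul_left hs _

end Bridge

/-! ### Exceptional events and the dual vector. -/

section Assembly

variable {Ω 𝒴 : Type*} [MeasurableSpace Ω] [MeasurableSpace 𝒴] {N k p : ℕ}
  {P : Measure Ω} [IsProbabilityMeasure P] {Y : Fin N → Ω → 𝒴}
  {Z : Fin N → Matrix (Fin k) (Fin p) ℝ} {γ : Fin N → (Fin k → ℝ) → 𝒴 → ℝ}
  {D : Set (Fin p → ℝ)} {θ : Fin p → ℝ}

/-- The remainder of the linear approximation is at most `tailBound · ‖u - v‖₁`, outside an event of
probability at most `q`. -/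
theorem exists_event_remainder_le (hk : 0 < k) (hp : 0 < p) (hY : ∀ i, Measurable (Y i))
    (hYindep : iIndepFun Y P) (hθ : θ ∈ D) (hγmeas : ∀ i t, Measurable (γ i t))
    (hγint : ∀ i, Integrable (fun ω => γ i (Z i *ᵥ θ) (Y i ω)) P)
    (hγdiff : ∀ i y, Differentiable ℝ (fun t => γ i t y))
    (hF₁ : F₁ γ < ∞) (hF₂ : F₂ γ < ∞) {q : ℝ} (hq : 0 < q) (hq1 : q < 1) :
    ∃ Bad : Set Ω, P Bad ≤ ENNReal.ofReal q ∧ ∀ ω ∉ Bad, ∀ u ∈ D, ∀ v ∈ D,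
      ‖centeredLoss P γ Y Z u ω - centeredLoss P γ Y Z v ω - linearTerm P γ Y Z θ (u - v) ω‖ₑ ≤
        tailBound γ Z D q * l1Norm (u - v) := by
  have hf₁ := abs_partialDeriv_le_F₁ hF₁
  have hf₂ := abs_partialDeriv_sub_le_F₂ hF₂
  have hM := abs_le_MZ (Z := Z)
  by_cases hD : RD D < ∞
  · set R := (RD D).toReal with hR
    set L := Real.log (p / q) with hLdef
    set φ := 2 * min (F₁ γ).toReal ((F₂ γ).toReal * (MZ Z).toReal * R) with hφdef
    have hp0 : (0 : ℝ) < p := by exact_mod_cast hp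
    have hL : 0 ≤ L := Real.log_nonneg (by
      rw [le_div_iff₀ hq]
      have : (1 : ℝ) ≤ p := by exact_mod_cast hp
      linarith)
    have hφ0 : 0 ≤ φ := by positivity
    -- The increment is at most both `2 F₁` and `F₂ M_Z R`, hence at most twice the smaller of `F₁`
    -- and `F₂ M_Z R`.
    have hφ : ∀ w : Fin p → ℝ, ∑ l, |(w - θ) l| ≤ R → ∀ i j y,
        |gradAt γ Z i j w y - gradAt γ Z i j θ y| ≤ φ := by
      intro w hw i j y
      have h1 : |gradAt γ Z i j w y - gradAt γ Z i j θ y| ≤ 2 * (F₁ γ).toReal := by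
        rw [two_mul]
        exact (abs_sub _ _).trans (add_le_add (hf₁ i j _ y) (hf₁ i j _ y))
      have h2 : |gradAt γ Z i j w y - gradAt γ Z i j θ y| ≤
          (F₂ γ).toReal * (MZ Z).toReal * R := by
        refine (hf₂ i j _ _ y).trans ?_
        rw [← Matrix.mulVec_sub, mul_assoc]
        exact mul_le_mul_of_nonneg_left (norm_mulVec_le ENNReal.toReal_nonneg hM hw i)
          ENNReal.toReal_nonneg
      have h3 : 0 ≤ (F₂ γ).toReal * (MZ Z).toReal * R := by positivity
      rw [hφdef, mul_min_of_nonneg _ _ two_pos.le]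
      exact le_min h1 (by linarith)
    set s := 2 * (2 * ∑ j, k * (F₂ γ).toReal * (MZ Z).toReal * R *
      (√2 * √(Real.log (2 * p)) * √(colMax Z j))) + √(2 * k) * φ * √(L * totalMax Z) with hs
    refine ⟨⋃ h : Fin p, {ω | ∃ w : Fin p → ℝ, ∑ l, |(w - θ) l| ≤ R ∧
      s < |gradIncrement P γ Y Z θ w h ω|}, ?_, ?_⟩
    · refine (measure_iUnion_fintype_le _ _).trans ((Finset.sum_le_sum fun h _ =>
        gradIncrement_tail_ball hk hp hY hYindep hγmeas hγdiff hf₁ hf₂ ENNReal.toReal_nonneg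
          ENNReal.toReal_nonneg hM ENNReal.toReal_nonneg hφ0 hφ le_colMax h (le_totalMax h)
          hL).trans ?_)
      rw [exp_neg_log_div hp0 hq, Finset.sum_const, Finset.card_univ, Fintype.card_fin,
        nsmul_eq_mul, ← ENNReal.ofReal_natCast, ← ENNReal.ofReal_mul hp0.le,
        mul_div_cancel₀ _ hp0.ne']
    · intro ω hω u hu v hv
      have hω' : ∀ w : Fin p → ℝ, ∑ l, |(w - θ) l| ≤ R → ∀ h,
          |gradIncrement P γ Y Z θ w h ω| ≤ s := by
        intro w hw h
        by_contra hlt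
        exact hω (Set.mem_iUnion.2 ⟨h, w, hw, not_le.1 hlt⟩)
      refine enorm_le_mul_l1Norm (s := s) (abs_remainder_le hY hγmeas hγdiff hγint hf₁
        fun t ht h => hω' _ (sum_abs_segment_sub_le (sum_abs_sub_le_RD hD hu hθ)
          (sum_abs_sub_le_RD hD hv hθ) ht) h) ?_
      -- The term with `constC` is dropped here.
      refine ENNReal.ofReal_add_le.trans (le_trans ?_ le_self_add)
      exact add_le_add (ofReal_expectation_part_le hk hp hF₂ hD)
        (ofReal_deviation_part_le hp hF₁ hF₂ hD hL)
  · have hDtop : RD D = ∞ := not_lt_top_iff.1 hD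
    refine ⟨∅, by simp, fun ω _ u hu v hv => ?_⟩
    -- For `u = v` the right side is `∞ * 0 = 0` when the bound is infinite, so the remainder has to
    -- vanish.
    rcases eq_or_ne u v with rfl | huv
    · simp [linearTerm]
    -- In the degenerate case the gradient does not depend on `w` and the approximation is exact.
    by_cases hdeg : MZ Z = 0 ∨ F₂ γ = 0
    · have hgrad : ∀ i j (w : Fin p → ℝ), gradAt γ Z i j w = gradAt γ Z i j θ := by
        intro i j w
        funext y
        rw [← sub_eq_zero, ← abs_nonpos_iff]
        rcases hdeg with h0 | h0
        · have hZ : Z i = 0 := by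
            ext a b
            have := hM i a b
            rw [h0, ENNReal.toReal_zero] at this
            exact abs_nonpos_iff.1 this
          simp [gradAt, hZ]
        · refine (hf₂ i j _ _ y).trans ?_
          simp [h0]
      have h1 := abs_remainder_le (C := 0) (u := u) (v := v) (ω := ω) hY hγmeas hγdiff hγint hf₁
        fun t _ h => by simp [gradIncrement, linearTerm_single, hgrad]
      exact enorm_le_mul_l1Norm h1 (by simp)
    · rw [not_or] at hdeg
      rw [tailBound_eq_top hk hp hDtop hdeg.1 hdeg.2, ENNReal.top_mul]
      · exact le_top
      · intro h0
        simp only [l1Norm, Finset.sum_eq_zero_iff, Finset.mem_univ, true_imp_iff,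
          enorm_eq_zero] at h0
        exact huv (sub_eq_zero.1 (funext h0))

/-- The term is linear in `d`, so its `p` coefficients suffice; two signs for each give `2p` in the
logarithm. -/
theorem exists_event_linearTerm_le (hp : 0 < p) (hY : ∀ i, Measurable (Y i))
    (hYindep : iIndepFun Y P) (hγmeas : ∀ i t, Measurable (γ i t))
    (hγdiff : ∀ i y, Differentiable ℝ (fun t => γ i t y)) (hF₁ : F₁ γ < ∞) {q : ℝ} (hq : 0 < q)
    (hq1 : q < 1) :
    ∃ Bad : Set Ω, P Bad ≤ ENNReal.ofReal q ∧ ∀ ω ∉ Bad, ∀ d,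
      ‖linearTerm P γ Y Z θ d ω‖ₑ ≤ linearBound γ Z q * l1Norm d := by
  have hp0 : (0 : ℝ) < p := by exact_mod_cast hp
  set L := Real.log (2 * p / q) with hLdef
  have hL : 0 ≤ L := Real.log_nonneg (by
    rw [le_div_iff₀ hq]
    have : (1 : ℝ) ≤ p := by exact_mod_cast hp
    linarith)
  set s := √(2 * k) * (F₁ γ).toReal * √(L * totalMax Z)
  refine ⟨⋃ h : Fin p, {ω | s < |linearTerm P γ Y Z θ (Pi.single h 1) ω|}, ?_, ?_⟩
  · refine (measure_iUnion_fintype_le _ _).trans ((Finset.sum_le_sum fun h _ =>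
      abs_linearTerm_tail hY hYindep hγmeas hγdiff ENNReal.toReal_nonneg
        (abs_partialDeriv_le_F₁ hF₁) h (le_totalMax h) hL).trans ?_)
    rw [exp_neg_log_div (by positivity) hq, Finset.sum_const, Finset.card_univ, Fintype.card_fin,
      nsmul_eq_mul, ← ENNReal.ofReal_natCast, ← ENNReal.ofReal_mul hp0.le]
    refine ENNReal.ofReal_le_ofReal (le_of_eq ?_)
    field_simp
  · intro ω hω d
    refine enorm_le_mul_l1Norm (s := s) ?_ (ofReal_linear_part_le hp hF₁ hL)
    rw [linearTerm_eq_sum]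
    refine abs_sum_mul_le fun h => ?_
    by_contra hlt
    exact hω (Set.mem_iUnion.2 ⟨h, not_le.1 hlt⟩)

/-- The `ℓ_∞`-minimal vector with inner product `a` with `d`. -/
noncomputable def dualVector (a : ℝ) (d : Fin p → ℝ) : Fin p → ℝ :=
  fun h => a / (∑ l, |d l|) * SignType.sign (d h)

theorem dualVector_dotProduct {a : ℝ} {d : Fin p → ℝ} (h : d = 0 → a = 0) :
    dualVector a d ⬝ᵥ d = a := by
  have e : dualVector a d ⬝ᵥ d = a / (∑ l, |d l|) * ∑ l, |d l| := by
    simp only [dotProduct, dualVector, Finset.mul_sum]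
    refine Finset.sum_congr rfl fun l _ => ?_
    rw [mul_assoc, sign_mul_self]
  rw [e]
  by_cases hd : ∑ l, |d l| = 0
  · rw [hd, mul_zero, h]
    funext l
    rw [Finset.sum_eq_zero_iff_of_nonneg fun _ _ => abs_nonneg _] at hd
    exact abs_eq_zero.1 (hd l (Finset.mem_univ l))
  · exact div_mul_cancel₀ _ hd

theorem enorm_dualVector_le {a : ℝ} {d : Fin p → ℝ} {b : ℝ≥0∞} (h : ‖a‖ₑ ≤ b * l1Norm d) :
    ‖dualVector a d‖ₑ ≤ b := by
  rw [enorm_pi_eq_iSup]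
  refine iSup_le fun l => ?_
  rcases (Finset.sum_nonneg fun l (_ : l ∈ Finset.univ) => abs_nonneg (d l)).eq_or_lt with h0 | h0
  -- For `d = 0`, division by zero makes the dual vector `0`.
  · simp [dualVector, ← h0]
  · rw [← ENNReal.mul_le_mul_iff_left (ENNReal.ofReal_pos.2 h0).ne' ENNReal.ofReal_ne_top,
      ← l1Norm_eq_ofReal]
    refine le_trans ?_ h
    rw [l1Norm_eq_ofReal, ← ofReal_norm, ← ofReal_norm, ← ENNReal.ofReal_mul (norm_nonneg _)]
    refine ENNReal.ofReal_le_ofReal ?_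
    rw [dualVector, norm_mul, norm_div, Real.norm_eq_abs (∑ l, |d l|), abs_of_pos h0,
      mul_right_comm, div_mul_cancel₀ _ h0.ne']
    refine mul_le_of_le_one_right (norm_nonneg _) ?_
    rcases SignType.sign (d l) with _ | _ | _ <;> simp

end Assembly

end StochLip

/-! ### Both conclusions from the exceptional events. -/

theorem mainTheorem6 {Ω 𝒴 : Type*} [MeasurableSpace Ω] [MeasurableSpace 𝒴]
    (P : Measure Ω) [IsProbabilityMeasure P]
    (N k p : ℕ) (hk : 0 < k) (hp : 0 < p)
    (Y : Fin N → Ω → 𝒴) (hY : ∀ i, Measurable (Y i)) (hYindep : iIndepFun Y P)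
    (Z : Fin N → Matrix (Fin k) (Fin p) ℝ)
    (D : Set (Fin p → ℝ)) (θ : Fin p → ℝ) (hθ : θ ∈ D)
    (γ : Fin N → (Fin k → ℝ) → 𝒴 → ℝ)
    (hγmeas : ∀ i t, Measurable (γ i t))
    (hγint : ∀ i, ∀ u ∈ D, Integrable (fun ω => γ i (Z i *ᵥ u) (Y i ω)) P)
    (hγdiff : ∀ i y, Differentiable ℝ (fun t => γ i t y))
    (hF₁ : StochLip.F₁ γ < ∞) (hF₂ : StochLip.F₂ γ < ∞) :
    StochLip.betaConst (2 * k) ≤ ((3 ^ (2 * k) + 3 ^ (2 * k - 1) - 2 ^ (2 * k) : ℕ) : ℝ≥0∞) ∧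
    (∃ ξ : (Fin p → ℝ) → (Fin p → ℝ) → Ω → (Fin p → ℝ),
      (∀ u ∈ D, ∀ v ∈ D, Measurable (ξ u v)) ∧
      (∀ u ∈ D, ∀ v ∈ D, ∀ ω,
        StochLip.centeredLoss P γ Y Z u ω - StochLip.centeredLoss P γ Y Z v ω =
          StochLip.linearTerm P γ Y Z θ (u - v) ω + ξ u v ω ⬝ᵥ (u - v)) ∧
      (∀ q : ℝ, 0 < q → q < 1 →
        P {ω | StochLip.tailBound γ Z D q < ⨆ u ∈ D, ⨆ v ∈ D, ‖ξ u v ω‖ₑ} ≤ ENNReal.ofReal q)) ∧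
    (∀ q₀ q q' : ℝ, 0 < q₀ → q₀ < 1 → 0 < q → q < 1 → 0 < q' → q' < 1 → q + q' = q₀ →
      ENNReal.ofReal (1 - q₀) ≤
        P {ω | (⨆ u ∈ D, ⨆ v ∈ D, ⨆ _ : u ≠ v,
            ‖StochLip.centeredLoss P γ Y Z u ω - StochLip.centeredLoss P γ Y Z v ω‖ₑ
              / StochLip.l1Norm (u - v)) ≤
          StochLip.linearBound γ Z q' + StochLip.tailBound γ Z D q}) := by
  have hint : ∀ i, Integrable (fun ω => γ i (Z i *ᵥ θ) (Y i ω)) P := fun i => hγint i θ hθ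
  refine ⟨StochLip.betaConst_two_mul_le hk, ⟨fun u v ω => StochLip.dualVector
    (StochLip.centeredLoss P γ Y Z u ω - StochLip.centeredLoss P γ Y Z v ω
      - StochLip.linearTerm P γ Y Z θ (u - v) ω) (u - v), ?_, ?_, ?_⟩, ?_⟩
  · intro u _ v _
    refine measurable_pi_lambda _ fun h => ?_
    exact ((((StochLip.measurable_centeredLoss hY hγmeas u).sub
      (StochLip.measurable_centeredLoss hY hγmeas v)).sub
      (StochLip.measurable_linearTerm hY hγmeas hγdiff (u - v))).div_const _).mul_const _
  · intro u _ v _ ω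
    rw [StochLip.dualVector_dotProduct]
    · ring
    · intro huv
      rw [sub_eq_zero.1 huv]
      simp [StochLip.linearTerm]
  · intro q hq hq1
    obtain ⟨Bad, hBad, hgood⟩ := StochLip.exists_event_remainder_le (P := P) (Z := Z) (D := D)
      hk hp hY hYindep hθ hγmeas hint hγdiff hF₁ hF₂ hq hq1
    refine (measure_mono fun ω hω => ?_).trans hBad
    by_contra hn
    rw [Set.mem_ofPred_eq] at hω
    refine absurd hω (not_lt.2 ?_)
    exact iSup₂_le fun u hu => iSup₂_le fun v hv =>
      StochLip.enorm_dualVector_le (hgood ω hn u hu v hv)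
  · intro q₀ q q' _ _ hq hq1 hq' hq'1 hsum
    obtain ⟨Bad, hBad, hgood⟩ := StochLip.exists_event_remainder_le (P := P) (Z := Z) (D := D)
      hk hp hY hYindep hθ hγmeas hint hγdiff hF₁ hF₂ hq hq1
    obtain ⟨Bad', hBad', hgood'⟩ := StochLip.exists_event_linearTerm_le (P := P) (Z := Z) (θ := θ)
      hp hY hYindep hγmeas hγdiff hF₁ hq' hq'1
    set G := {ω | (⨆ u ∈ D, ⨆ v ∈ D, ⨆ _ : u ≠ v,
            ‖StochLip.centeredLoss P γ Y Z u ω - StochLip.centeredLoss P γ Y Z v ω‖ₑ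
              / StochLip.l1Norm (u - v)) ≤
          StochLip.linearBound γ Z q' + StochLip.tailBound γ Z D q} with hG
    -- Covering the whole space requires only subadditivity, so the supremum over the arbitrary set
    -- `D` need not be measurable.
    have hcover : Set.univ ⊆ G ∪ (Bad ∪ Bad') := by
      intro ω _
      by_cases h1 : ω ∈ Bad
      · exact Or.inr (Or.inl h1)
      by_cases h2 : ω ∈ Bad'
      · exact Or.inr (Or.inr h2)
      refine Or.inl ?_
      rw [hG, Set.mem_ofPred_eq]
      refine iSup₂_le fun u hu => iSup₂_le fun v hv => iSup_le fun _ => ?_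
      refine ENNReal.div_le_of_le_mul ?_
      rw [add_mul]
      refine le_trans ?_ (add_le_add (hgood' ω h2 (u - v)) (hgood ω h1 u hu v hv))
      refine le_trans (le_of_eq ?_) (enorm_add_le _ _)
      congr 1
      ring
    have hle := (measure_mono hcover).trans ((measure_union_le (μ := P) _ _).trans
      (add_le_add le_rfl ((measure_union_le _ _).trans (add_le_add hBad hBad'))))
    rw [measure_univ, ← ENNReal.ofReal_add hq.le hq'.le, hsum] at hle
    rw [ENNReal.ofReal_sub _ (by linarith), ENNReal.ofReal_one]
    exact tsub_le_iff_right.2 hle
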